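/- Let $b\ge 2$ and $\Sigma=\{0,\dots,b-1\}$. Consider a Markov source on $\Sigma$ with initial distribution $(\mu_i)_{i\in\Sigma}$ and transition matrix $(p_{ij})_{i,j\in\Sigma}$, where $0<\mu_i,p_{ij}<1$ for all $i,j$, and let $S_1,S_2,\dots$ be independent random strings in $\Sigma^\infty$ generated by it. Order $\Sigma^\infty$ lexicographically. For $v\in\Sigma^\infty$ let $\Lambda_{n,k}(v)$ be the number of $1\le i\le n$ such that $S_i$ and $v$ agree in their first $k$ symbols, and put $$Z_n(v)=\sum_{k\ge0}\Lambda_{n,k}(v)\mathbf 1_{\{\Lambda_{n,k}(v)>1\}},\qquad Y_n(\ell)=Z_n(S_{(\ell)})\quad(1\le\ell\le n),\qquad Y_n(n+1):=Y_n(n),$$ where $S_{(1)}<\dots<S_{(n)}$ are the (almost surely distinct) order statistics of $S_1,\dots,S_n$; thus $Y_n(\ell)$ is the number of bucket operations of Radix Selection with $b$ buckets searching for the element of rank $\ell$. For $w=w_1w_2\ldots\in\Sigma^\infty$ and $t\in[0,1]$ let $$m(w)=1+\sum_{k\ge1}\mu_{w_1}p_{w_1w_2}\cdots p_{w_{k-1}w_k},\qquad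 F(w)=\mathbb P(S_1\le w),\qquad h(t)=\sup\{v\in\Sigma^\infty:F(v)\le t\},$$ $$\mathcal Y_n(t)=\frac{Y_n(\lfloor tn\rfloor+1)-m(h(t))\,n}{\sqrt n},\qquad n\ge1 .$$ Suppose that there is no $\beta>0$ such that $p_{ir}=\frac{1-\beta}{1-\beta^b}\beta^r$ for all $i,r\in\Sigma$ (where the right-hand side is read as $1/b$ if $\beta=1$). Then for all $0\le u<v\le1$ the following hold. The restrictions of the processes $\mathcal Y_n$, $n\ge1$, to $[u,v]$ are (up to null sets) random elements of the space $D([u,v])$ of real càdlàg functions on $[u,v]$ with Skorokhod's $J_1$-topology, and the sequence of their distributions on $D([u,v])$ is not tight. Moreover, there is $t\in[u,v]$ such that the sequence of distributions of the real random variables $\mathcal Y_n(t)$, $n\ge1$, is not tight. -/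

import Mathlib

open MeasureTheory ProbabilityTheory Filter Topology

noncomputable section

/-! ### Strings and Markov sources -/

/-- Infinite strings over the alphabet `{0, …, b - 1}`; the `i`-th symbol of the string
`v₁ v₂ …` is `v (i - 1)`. The σ-algebra is the product σ-algebra. The order is the lexicographic
one, accessed through `toLex`. -/
abbrev Str (b : ℕ) : Type := ℕ → Fin b

/-- The parameters of a Markov source on `{0, …, b - 1}`: an initial distribution `init` and a
transition matrix `trans`, all of whose entries lie in the open interval `(0, 1)`. -/
structure MarkovSource (b : ℕ) where
  init : Fin b → ℝ
  trans : Fin b → Fin b → ℝ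
  init_pos : ∀ i, 0 < init i
  init_lt_one : ∀ i, init i < 1
  init_sum : ∑ i, init i = 1
  trans_pos : ∀ i j, 0 < trans i j
  trans_lt_one : ∀ i j, trans i j < 1
  trans_sum : ∀ i, ∑ j, trans i j = 1

namespace MarkovSource

variable {b : ℕ} (M : MarkovSource b)

/-- The fundamental probability `π(w₁ ⋯ w_k) = μ_{w₁} p_{w₁ w₂} ⋯ p_{w_{k-1} w_k}` of the prefix of
length `k` of the string `w`, with `π(∅) = 1`. -/
def prefixProb (w : Str b) : ℕ → ℝ
  | 0 => 1
  | k + 1 => M.init (w 0) * ∏ l ∈ Finset.range k, M.trans (w l) (w (l + 1))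

/-- `m(w) = ∑_{v ⪯ w} π(v)`, the sum over all finite prefixes of `w` (including the empty one). -/
def m (w : Str b) : ℝ := ∑' k : ℕ, M.prefixProb w k

end MarkovSource

/-- The weights `(1 - β) β ^ r / (1 - β ^ b)`, read as `1 / b` for `β = 1`. -/
def geomWeight (b : ℕ) (β : ℝ) (r : Fin b) : ℝ :=
  if β = 1 then 1 / (b : ℝ) else (1 - β) / (1 - β ^ b) * β ^ (r : ℕ)

/-- `S 0, S 1, …` are independent random strings, each generated by the Markov source `M`, i.e. the
symbols of each string form a Markov chain with initial distribution and transition matrix given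
by `M`. -/
structure IsMarkovSample {b : ℕ} (M : MarkovSource b) {Ω : Type*} [MeasurableSpace Ω]
    (P : Measure Ω) (S : ℕ → Ω → Str b) : Prop where
  measurable : ∀ i, Measurable (S i)
  indep : iIndepFun S P
  prefix_law : ∀ (i : ℕ) (w : Str b) (k : ℕ),
    P {ω | ∀ l < k, S i ω l = w l} = ENNReal.ofReal (M.prefixProb w k)

/-! ### Distribution function and quantile function on strings -/

/-- `F(w) = P(X ≤ w)`, the distribution function of a random string, for the lexicographic
order. -/
def strCDF {b : ℕ} {Ω : Type*} [MeasurableSpace Ω] (P : Measure Ω) (X : Ω → Str b)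
    (w : Str b) : ℝ :=
  P.real {ω | toLex (X ω) ≤ toLex w}

/-- `h(t) = sup {v | F(v) ≤ t}`, the supremum being that of the complete lexicographic order. -/
def strQuantile {b : ℕ} [NeZero b] {Ω : Type*} [MeasurableSpace Ω] (P : Measure Ω)
    (X : Ω → Str b) (t : ℝ) : Str b :=
  ofLex (sSup {v : Lex (Str b) | strCDF P X (ofLex v) ≤ t})

/-! ### The complexity of Radix Selection -/

section Radix

variable {b : ℕ} (x : ℕ → Str b) (n : ℕ)

/-- `Λ_{n,k}(v)`: the number of strings among the first `n` whose longest common prefix with `v` has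
length at least `k`, i.e. which agree with `v` in the first `k` symbols. -/
def prefixCount (k : ℕ) (v : Str b) : ℕ :=
  ((Finset.range n).filter fun i => ∀ l < k, x i l = v l).card

/-- `Z_n(v) = ∑_{k ≥ 0} Λ_{n,k}(v) 1{Λ_{n,k}(v) > 1}`. If the first `n` strings are distinct, the sum
has finitely many non-zero terms. -/
def pathCost (v : Str b) : ℝ :=
  ∑' k : ℕ, if 1 < prefixCount x n k v then (prefixCount x n k v : ℝ) else 0

/-- The order statistic `S_{(ℓ)}` of the first `n` strings, `1 ≤ ℓ ≤ n`, for the lexicographic order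
(the value for other `ℓ` is irrelevant). -/
def orderStat (l : ℕ) : Str b :=
  if hl : 1 ≤ l ∧ l ≤ n then
    x (Tuple.sort (fun i : Fin n => toLex (x i)) ⟨l - 1, by omega⟩)
  else x 0

/-- `Y_n(ℓ) = Z_n(S_{(ℓ)})` for `1 ≤ ℓ ≤ n`, the number of bucket operations used by Radix Selection
to find the element of rank `ℓ` among the first `n` strings; moreover `Y_n(n + 1) = Y_n(n)`. -/
def radixCost (l : ℕ) : ℝ := pathCost x n (orderStat x n (min l n))

end Radix

/-- The normalized process
`𝒴_n(t) = (Y_n(⌊t n⌋ + 1) - m(h(t)) n) / √n`, for `0 ≤ t ≤ 1` and `n ≥ 1`. -/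
def normProc {b : ℕ} [NeZero b] (M : MarkovSource b) {Ω : Type*} [MeasurableSpace Ω]
    (P : Measure Ω) (S : ℕ → Ω → Str b) (n : ℕ) (t : ℝ) (ω : Ω) : ℝ :=
  (radixCost (fun i => S i ω) n (⌊t * n⌋₊ + 1) - M.m (strQuantile P (S 0) t) * n) / √(n : ℝ)

/-! ### The Skorokhod space `D[a,b]` -/

/-- `f` is càdlàg: right-continuous with left limits. On a closed interval, right-continuity is void
at the right end point, as is the existence of the left limit at the left end point. -/
def IsCadlag {α : Type*} [TopologicalSpace α] [Preorder α] (f : α → ℝ) : Prop :=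
  ∀ t, Tendsto f (𝓝[>] t) (𝓝 (f t)) ∧ ∃ l, Tendsto f (𝓝[<] t) (𝓝 l)

/-- The space `D[u,v]` of real càdlàg functions on the closed interval `[u,v]`. -/
structure SkorokhodSpace (u v : ℝ) where
  toFun : Set.Icc u v → ℝ
  cadlag : IsCadlag toFun

namespace SkorokhodSpace

variable {u v : ℝ}

/-- The set of `g` for which some increasing bijection `τ` of `[u,v]` satisfies
`|τ(t) - t| < ε` and `|g(τ(t)) - f(t)| < ε` for all `t`. (An increasing bijection of `[u,v]` is
automatically a homeomorphism.) -/
def ball (f : SkorokhodSpace u v) (ε : ℝ) : Set (SkorokhodSpace u v) :=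
  {g | ∃ τ : Set.Icc u v ≃o Set.Icc u v,
    ∀ t, |(τ t : ℝ) - (t : ℝ)| < ε ∧ |g.toFun (τ t) - f.toFun t| < ε}

/-- Skorokhod's `J₁`-topology on `D[u,v]`: the topology of the metric
`d(f,g) = inf_τ max (‖τ - id‖, ‖g ∘ τ - f‖)`. -/
instance : TopologicalSpace (SkorokhodSpace u v) where
  IsOpen U := ∀ f ∈ U, ∃ ε > 0, ball f ε ⊆ U
  isOpen_univ := fun _ _ => ⟨1, one_pos, Set.subset_univ _⟩
  isOpen_inter := by
    rintro U V hU hV f ⟨hfU, hfV⟩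
    obtain ⟨ε, hε, h₁⟩ := hU f hfU
    obtain ⟨δ, hδ, h₂⟩ := hV f hfV
    refine ⟨min ε δ, lt_min hε hδ, ?_⟩
    rintro g ⟨τ, hτ⟩
    exact ⟨h₁ ⟨τ, fun t => ⟨(hτ t).1.trans_le (min_le_left _ _),
        (hτ t).2.trans_le (min_le_left _ _)⟩⟩,
      h₂ ⟨τ, fun t => ⟨(hτ t).1.trans_le (min_le_right _ _),
        (hτ t).2.trans_le (min_le_right _ _)⟩⟩⟩
  isOpen_sUnion := by
    rintro 𝒰 h𝒰 f ⟨U, hU, hf⟩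
    obtain ⟨ε, hε, h⟩ := h𝒰 U hU f hf
    exact ⟨ε, hε, h.trans (Set.subset_sUnion_of_mem hU)⟩

instance : MeasurableSpace (SkorokhodSpace u v) := borel _

instance : BorelSpace (SkorokhodSpace u v) := ⟨rfl⟩

open Classical in
/-- The restriction to `[u,v]` of a function on the line, as an element of `D[u,v]`
(and the zero function if that restriction is not càdlàg). -/
def restrict (u v : ℝ) (f : ℝ → ℝ) : SkorokhodSpace u v :=
  if hf : IsCadlag (fun t : Set.Icc u v => f t) then ⟨fun t => f t, hf⟩
  else ⟨fun _ => 0, fun _ => ⟨tendsto_const_nhds, 0, tendsto_const_nhds⟩⟩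

end SkorokhodSpace

end

/-!
The function `m ∘ h` jumps in every interval. At a finite word, the two neighbouring strings
`w a (b-1) (b-1) ⋯` and `w (a+1) 0 0 ⋯` have the same value `t` under the distribution function `F`,
and `h(t)` is the larger one. If `m` took the same value at both of them for all words in some
cylinder, the transition matrix would have to consist of geometric weights
(`exists_trans_eq_geomWeight`). So every interval `[u,v]` contains the level `t` of a pair of
neighbours with different values of `m` (`IsLaw.exists_m_maxBelow_ne`).

Fix such a level `t`, with left neighbour `y`. The centring of `𝒴_n(t)` is `m(h(t)) n`, which
belongs to the right neighbour. The number of strings that are at most `y` is binomial with mean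
`t n`, and by the central limit theorem it exceeds `t n` with probability bounded away from zero
(`exists_eventually_le_measure_countIn`). In this case the string of rank `⌊t n⌋ + 1` is at most
`y`, and by the law of large numbers it shares any fixed number of symbols with `y`
(`orderStat_mem_cylinder`). Its search cost is then `m(y) n + o(n)`: the first levels are again
controlled by the law of large numbers, and the deep levels, uniformly in the searched string, by
the number of pairs of strings with a long common prefix (`measure_pairTail_le`). Hence `|𝒴_n(t)|` is at
least of the order `√n` with probability bounded away from zero (`exists_lt_measure_normProc`).

This excludes tightness of the marginal at `t`, and also tightness on `D[u,v]`, because compact sets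
for the `J₁`-topology are bounded in supremum norm (`exists_subset_boundedPaths`). The paths are
càdlàg since `h` is right-continuous with left limits for the product topology on strings, for which
`m` is continuous; they are random elements of `D[u,v]` because a path depends continuously on its
finitely many random step heights.
-/

noncomputable section

namespace RadixSelection

variable {b : ℕ}

/-! ### Strings in lexicographic order -/

theorem toLex_lt_iff {x y : Str b} :
    toLex x < toLex y ↔ ∃ i, (∀ j < i, x j = y j) ∧ x i < y i := Iff.rfl

/-- The string that starts with the first `k` symbols of `w` and continues with the constant
symbol `c`. -/
def constTail (w : Str b) (k : ℕ) (c : Fin b) : Str b := fun l => if l < k then w l else c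

theorem constTail_of_lt {w : Str b} {k l : ℕ} (c : Fin b) (h : l < k) :
    constTail w k c l = w l := if_pos h

theorem constTail_of_le {w : Str b} {k l : ℕ} (c : Fin b) (h : k ≤ l) :
    constTail w k c l = c := if_neg h.not_gt

/-- In the lexicographic order a cylinder is a closed interval. -/
theorem mem_cylinder_iff_toLex [NeZero b] {w x : Str b} {k : ℕ} :
    x ∈ PiNat.cylinder w k ↔
      toLex (constTail w k ⊥) ≤ toLex x ∧ toLex x ≤ toLex (constTail w k ⊤) := by
  constructor
  · intro hx
    have hx' : ∀ l < k, x l = w l := hx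
    constructor
    · by_contra! h
      obtain ⟨i, -, hi⟩ := toLex_lt_iff.1 h
      rcases lt_or_ge i k with hik | hik
      · rw [constTail_of_lt _ hik, hx' i hik] at hi
        exact lt_irrefl _ hi
      · rw [constTail_of_le _ hik] at hi
        exact not_lt_bot hi
    · by_contra! h
      obtain ⟨i, -, hi⟩ := toLex_lt_iff.1 h
      rcases lt_or_ge i k with hik | hik
      · rw [constTail_of_lt _ hik, hx' i hik] at hi
        exact lt_irrefl _ hi
      · rw [constTail_of_le _ hik] at hi
        exact not_top_lt hi
  · rintro ⟨h₁, h₂⟩ l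
    induction l using Nat.strong_induction_on with
    | _ l ih =>
      intro hl
      have e₁ := Pi.apply_le_of_toLex h₁ (i := l) fun j hj => by
        rw [constTail_of_lt _ (hj.trans hl)]; exact (ih j hj (hj.trans hl)).symm
      have e₂ := Pi.apply_le_of_toLex h₂ (i := l) fun j hj => by
        rw [constTail_of_lt _ (hj.trans hl)]; exact ih j hj (hj.trans hl)
      rw [constTail_of_lt _ hl] at e₁ e₂
      exact le_antisymm e₂ e₁

theorem constTail_bot_le [NeZero b] (w : Str b) (k : ℕ) :
    toLex (constTail w k ⊥) ≤ toLex w :=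
  (mem_cylinder_iff_toLex.1 (PiNat.self_mem_cylinder w k)).1

theorem le_constTail_top [NeZero b] (w : Str b) (k : ℕ) :
    toLex w ≤ toLex (constTail w k ⊤) :=
  (mem_cylinder_iff_toLex.1 (PiNat.self_mem_cylinder w k)).2

/-- The string `w₁ ⋯ w_k a (b-1) (b-1) ⋯`, the largest one that starts with `w₁ ⋯ w_k a`. -/
def maxBelow [NeZero b] (w : Str b) (k : ℕ) (a : Fin b) : Str b :=
  constTail (Function.update w k a) (k + 1) ⊤

/-- The string `w₁ ⋯ w_k a 0 0 ⋯`, the smallest one that starts with `w₁ ⋯ w_k a`. -/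
def minAbove [NeZero b] (w : Str b) (k : ℕ) (a : Fin b) : Str b :=
  constTail (Function.update w k a) (k + 1) ⊥

theorem constTail_update (w : Str b) (k : ℕ) (a c : Fin b) (l : ℕ) :
    constTail (Function.update w k a) (k + 1) c l =
      if l < k then w l else if l = k then a else c := by
  unfold constTail
  rcases lt_trichotomy l k with h | h | h
  · rw [if_pos (by omega), if_pos h, Function.update_of_ne (by omega)]
  · subst h; simp
  · rw [if_neg (by omega), if_neg (by omega), if_neg (by omega)]

theorem maxBelow_apply [NeZero b] (w : Str b) (k : ℕ) (a : Fin b) (l : ℕ) :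
    maxBelow w k a l = if l < k then w l else if l = k then a else ⊤ :=
  constTail_update w k a ⊤ l

theorem minAbove_apply [NeZero b] (w : Str b) (k : ℕ) (a : Fin b) (l : ℕ) :
    minAbove w k a l = if l < k then w l else if l = k then a else ⊥ :=
  constTail_update w k a ⊥ l

theorem maxBelow_lt_minAbove [NeZero b] (w : Str b) (k : ℕ) {a a' : Fin b} (h : a < a') :
    toLex (maxBelow w k a) < toLex (minAbove w k a') := by
  refine toLex_lt_iff.2 ⟨k, fun j hj => ?_, ?_⟩
  · rw [maxBelow_apply, minAbove_apply, if_pos hj, if_pos hj]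
  · simpa [maxBelow_apply, minAbove_apply] using h

/-- The strings `w₁ ⋯ w_k a (b-1) (b-1) ⋯` and `w₁ ⋯ w_k (a+1) 0 0 ⋯` are neighbours in the
lexicographic order. -/
theorem minAbove_le_of_maxBelow_lt [NeZero b] {w x : Str b} {k : ℕ} {a a' : Fin b}
    (ha : (a' : ℕ) = a + 1) (h : toLex (maxBelow w k a) < toLex x) :
    toLex (minAbove w k a') ≤ toLex x := by
  obtain ⟨i, hi, hlt⟩ := toLex_lt_iff.1 h
  rw [maxBelow_apply] at hlt
  rcases lt_trichotomy i k with hik | hik | hik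
  · refine le_of_lt (toLex_lt_iff.2 ⟨i, fun j hj => ?_, ?_⟩)
    · rw [← hi j hj, maxBelow_apply, minAbove_apply, if_pos (hj.trans hik),
        if_pos (hj.trans hik)]
    · rw [minAbove_apply, if_pos hik]
      rwa [if_pos hik] at hlt
  · subst hik
    simp only [lt_irrefl, if_false, if_true] at hlt
    by_contra! hx
    obtain ⟨j, hj, hjlt⟩ := toLex_lt_iff.1 hx
    rw [minAbove_apply] at hjlt
    rcases lt_trichotomy j i with hji | hji | hji
    · have := hi j hji
      rw [maxBelow_apply, if_pos hji] at this
      rw [if_pos hji, this] at hjlt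
      exact lt_irrefl _ hjlt
    · subst hji
      simp only [lt_irrefl, if_false, if_true] at hjlt
      rw [Fin.lt_def] at hlt hjlt
      omega
    · rw [if_neg (by omega), if_neg (by omega)] at hjlt
      exact not_lt_bot hjlt
  · rw [if_neg (by omega), if_neg (by omega)] at hlt
    exact absurd hlt not_top_lt

theorem measurableSet_toLex_lt {Ω : Type*} [MeasurableSpace Ω] {f g : Ω → Str b}
    (hf : Measurable f) (hg : Measurable g) :
    MeasurableSet {ω | toLex (f ω) < toLex (g ω)} := by
  have : {ω | toLex (f ω) < toLex (g ω)} =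
      ⋃ i, (⋂ j, ⋂ (_ : j < i), {ω | f ω j = g ω j}) ∩ {ω | f ω i < g ω i} := by
    ext ω
    simp [toLex_lt_iff]
  rw [this]
  have hf' := measurable_pi_iff.1 hf
  have hg' := measurable_pi_iff.1 hg
  exact .iUnion fun i => (MeasurableSet.iInter fun j => .iInter fun _ =>
    measurableSet_eq_fun (hf' j) (hg' j)).inter (measurableSet_lt (hf' i) (hg' i))

theorem measurableSet_toLex_le {Ω : Type*} [MeasurableSpace Ω] {f g : Ω → Str b}
    (hf : Measurable f) (hg : Measurable g) :
    MeasurableSet {ω | toLex (f ω) ≤ toLex (g ω)} := by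
  convert (measurableSet_toLex_lt hg hf).compl using 1
  ext ω
  exact (not_lt (α := Lex (Str b))).symm

theorem measurableSet_agree {Ω : Type*} [MeasurableSpace Ω] {f g : Ω → Str b}
    (hf : Measurable f) (hg : Measurable g) (k : ℕ) :
    MeasurableSet {ω | ∀ l < k, f ω l = g ω l} := by
  have : {ω | ∀ l < k, f ω l = g ω l} = ⋂ l, ⋂ (_ : l < k), {ω | f ω l = g ω l} := by
    ext ω
    simp
  rw [this]
  exact .iInter fun l => .iInter fun _ => measurableSet_eq_fun
    (measurable_pi_iff.1 hf l) (measurable_pi_iff.1 hg l)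

theorem measurableSet_cylinder (w : Str b) (k : ℕ) : MeasurableSet (PiNat.cylinder w k) :=
  measurableSet_agree measurable_id measurable_const k

/-! ### The law of a random string -/

theorem prefixProb_pos (M : MarkovSource b) (w : Str b) (k : ℕ) : 0 < M.prefixProb w k := by
  cases k with
  | zero => exact one_pos
  | succ k => exact mul_pos (M.init_pos _) (Finset.prod_pos fun l _ => M.trans_pos _ _)

theorem prefixProb_congr (M : MarkovSource b) {w x : Str b} {k : ℕ}
    (h : x ∈ PiNat.cylinder w k) : M.prefixProb x k = M.prefixProb w k := by
  have h' : ∀ l < k, x l = w l := h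
  cases k with
  | zero => rfl
  | succ k =>
    simp only [MarkovSource.prefixProb]
    rw [h' 0 (by omega)]
    congr 1
    refine Finset.prod_congr rfl fun l hl => ?_
    rw [Finset.mem_range] at hl
    rw [h' l (by omega), h' (l + 1) (by omega)]

/-- Prefix probabilities decay exponentially, uniformly over all strings. -/
theorem exists_prefixProb_le_pow [NeZero b] (M : MarkovSource b) :
    ∃ q : ℝ, 0 < q ∧ q < 1 ∧ ∀ w k, M.prefixProb w k ≤ q ^ k := by
  let f : Fin b ⊕ Fin b × Fin b → ℝ := Sum.elim M.init fun p => M.trans p.1 p.2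
  have : Nonempty (Fin b ⊕ Fin b × Fin b) := ⟨.inl ⊥⟩
  obtain ⟨i₀, hi₀⟩ := Finite.exists_max f
  have hinit : ∀ i, M.init i ≤ f i₀ := fun i => hi₀ (.inl i)
  have htrans : ∀ i j, M.trans i j ≤ f i₀ := fun i j => hi₀ (.inr (i, j))
  have h0 : 0 < f i₀ := (M.init_pos ⊥).trans_le (hinit ⊥)
  refine ⟨f i₀, h0, ?_, fun w k => ?_⟩
  · rcases i₀ with i | ⟨i, j⟩
    · exact M.init_lt_one i
    · exact M.trans_lt_one i j
  · cases k with
    | zero => simp [MarkovSource.prefixProb]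
    | succ k =>
      rw [pow_succ']
      refine mul_le_mul (hinit _) ?_ (Finset.prod_nonneg fun l _ => (M.trans_pos _ _).le) h0.le
      calc ∏ l ∈ Finset.range k, M.trans (w l) (w (l + 1))
          ≤ ∏ _l ∈ Finset.range k, f i₀ :=
            Finset.prod_le_prod (fun l _ => (M.trans_pos _ _).le) fun l _ => htrans _ _
        _ = f i₀ ^ k := by simp

section Geometric

variable {M : MarkovSource b} {q : ℝ} (hq0 : 0 < q) (hq1 : q < 1)
  (hq : ∀ w k, M.prefixProb w k ≤ q ^ k)
include hq0 hq1 hq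

theorem summable_prefixProb (w : Str b) : Summable (M.prefixProb w) :=
  .of_nonneg_of_le (fun k => (prefixProb_pos M w k).le) (hq w)
    (summable_geometric_of_lt_one hq0.le hq1)

theorem sum_prefixProb_le_m (w : Str b) (k : ℕ) :
    ∑ j ∈ Finset.range k, M.prefixProb w j ≤ M.m w :=
  (summable_prefixProb hq0 hq1 hq w).sum_le_tsum _ fun j _ => (prefixProb_pos M w j).le

theorem m_le_sum_prefixProb_add (w : Str b) (k : ℕ) :
    M.m w ≤ ∑ j ∈ Finset.range k, M.prefixProb w j + q ^ k / (1 - q) := by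
  have hs := summable_prefixProb hq0 hq1 hq w
  rw [MarkovSource.m, ← hs.sum_add_tsum_nat_add k]
  gcongr
  calc ∑' i, M.prefixProb w (i + k) ≤ ∑' i, q ^ i * q ^ k := by
        refine ((summable_nat_add_iff k).2 hs).tsum_le_tsum (fun i => ?_)
          ((summable_geometric_of_lt_one hq0.le hq1).mul_right _)
        rw [← pow_add]; exact hq w _
    _ = q ^ k / (1 - q) := by
        rw [tsum_mul_right, tsum_geometric_of_lt_one hq0.le hq1]; ring

/-- `m` is continuous for the product topology, with an explicit modulus on cylinders. -/
theorem abs_m_sub_m_le {w x : Str b} {k : ℕ} (h : x ∈ PiNat.cylinder w k) :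
    |M.m x - M.m w| ≤ q ^ k / (1 - q) := by
  have e : ∑ j ∈ Finset.range k, M.prefixProb x j = ∑ j ∈ Finset.range k, M.prefixProb w j :=
    Finset.sum_congr rfl fun j hj => prefixProb_congr M fun l hl =>
      h l (hl.trans (Finset.mem_range.1 hj))
  have h₁ := sum_prefixProb_le_m hq0 hq1 hq x k
  have h₂ := sum_prefixProb_le_m hq0 hq1 hq w k
  have h₃ := m_le_sum_prefixProb_add hq0 hq1 hq x k
  have h₄ := m_le_sum_prefixProb_add hq0 hq1 hq w k
  rw [abs_le]
  constructor <;> linarith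

end Geometric

/-- `ν` is the law of a string generated by the Markov source `M`. -/
def IsLaw (M : MarkovSource b) (ν : Measure (Str b)) : Prop :=
  ∀ w k, ν (PiNat.cylinder w k) = ENNReal.ofReal (M.prefixProb w k)

theorem strCDF_eq_map {Ω : Type*} [MeasurableSpace Ω] (P : Measure Ω) {X : Ω → Str b}
    (hX : Measurable X) : strCDF P X = strCDF (P.map X) id := by
  ext w
  exact (map_measureReal_apply hX
    (measurableSet_toLex_le measurable_id measurable_const)).symm

theorem strQuantile_eq_map [NeZero b] {Ω : Type*} [MeasurableSpace Ω] (P : Measure Ω)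
    {X : Ω → Str b} (hX : Measurable X) : strQuantile P X = strQuantile (P.map X) id := by
  ext t
  simp only [strQuantile]
  rw [strCDF_eq_map P hX]

section Law

variable [NeZero b] {M : MarkovSource b} {ν : Measure (Str b)} [IsProbabilityMeasure ν]

omit [NeZero b] in
theorem strCDF_mono {w x : Str b} (h : toLex w ≤ toLex x) : strCDF ν id w ≤ strCDF ν id x :=
  measureReal_mono fun _ hy => le_trans (α := Lex (Str b)) hy h

variable (hν : IsLaw M ν)
include hν

omit [NeZero b] [IsProbabilityMeasure ν] in
theorem IsLaw.real_cylinder (w : Str b) (k : ℕ) :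
    ν.real (PiNat.cylinder w k) = M.prefixProb w k := by
  rw [Measure.real, hν, ENNReal.toReal_ofReal (prefixProb_pos M w k).le]

theorem IsLaw.real_singleton (w : Str b) : ν.real {w} = 0 := by
  obtain ⟨q, hq0, hq1, hq⟩ := exists_prefixProb_le_pow M
  refine le_antisymm (ge_of_tendsto' (tendsto_pow_atTop_nhds_zero_of_lt_one hq0.le hq1)
    fun k => ?_) measureReal_nonneg
  calc ν.real {w} ≤ ν.real (PiNat.cylinder w k) :=
        measureReal_mono (Set.singleton_subset_iff.2 (PiNat.self_mem_cylinder w k))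
    _ ≤ q ^ k := (hν.real_cylinder w k).trans_le (hq w k)

theorem IsLaw.strCDF_eq_lt (w : Str b) :
    strCDF ν id w = ν.real {x | toLex x < toLex w} := by
  refine le_antisymm ?_ (measureReal_mono fun x hx => le_of_lt (α := Lex (Str b)) hx)
  calc strCDF ν id w ≤ ν.real ({x | toLex x < toLex w} ∪ {w}) := measureReal_mono fun x hx => by
        rcases lt_or_eq_of_le (α := Lex (Str b)) hx with h | h
        · exact .inl h
        · exact .inr h
    _ ≤ _ := (measureReal_union_le _ _).trans_eq (by rw [hν.real_singleton, add_zero])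

theorem IsLaw.strCDF_constTail_top (w : Str b) (k : ℕ) :
    strCDF ν id (constTail w k ⊤) = strCDF ν id (constTail w k ⊥) + M.prefixProb w k := by
  rw [hν.strCDF_eq_lt (constTail w k ⊥), ← hν.real_cylinder,
    ← measureReal_union ?_ (measurableSet_cylinder w k)]
  · rw [strCDF]
    congr 1
    ext x
    rw [Set.mem_union, mem_cylinder_iff_toLex]
    have := (constTail_bot_le w k).trans (le_constTail_top w k)
    simp only [id, Set.mem_ofPred_eq]
    constructor
    · intro h
      by_cases h' : toLex x < toLex (constTail w k ⊥)
      · exact .inl h'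
      · exact .inr ⟨not_lt.1 h', h⟩
    · rintro (h | h)
      · exact h.le.trans this
      · exact h.2
  · rw [Set.disjoint_left]
    intro x hx hx'
    exact (mem_cylinder_iff_toLex.1 hx').1.not_gt hx

theorem IsLaw.strCDF_minAbove (w : Str b) (k : ℕ) {a a' : Fin b} (ha : (a' : ℕ) = a + 1) :
    strCDF ν id (minAbove w k a') = strCDF ν id (maxBelow w k a) := by
  refine le_antisymm ?_ (strCDF_mono (maxBelow_lt_minAbove w k (by rw [Fin.lt_def]; omega)).le)
  rw [hν.strCDF_eq_lt]
  refine measureReal_mono fun x hx => ?_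
  by_contra h
  exact (minAbove_le_of_maxBelow_lt ha (not_le.1 h)).not_gt hx

theorem IsLaw.strCDF_minAbove_lt {w x : Str b} {k : ℕ} {a : Fin b}
    (h : toLex (minAbove w k a) < toLex x) :
    strCDF ν id (minAbove w k a) < strCDF ν id x := by
  obtain ⟨i, hi, hlt⟩ := toLex_lt_iff.1 h
  set y := minAbove w k a with hy
  set K := max (k + 1) (i + 1)
  have e : constTail y K ⊥ = y := by
    ext1 l
    rcases lt_or_ge l K with hl | hl
    · exact constTail_of_lt _ hl
    · have : k < l := (le_max_left _ _).trans hl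
      rw [constTail_of_le _ hl, hy, minAbove_apply, if_neg (by omega), if_neg (by omega)]
  have hiK : i < K := le_max_right (k + 1) (i + 1)
  have hle : toLex (constTail y K ⊤) ≤ toLex x :=
    le_of_lt (toLex_lt_iff.2 ⟨i, fun j hj => by
      rw [constTail_of_lt _ (hj.trans hiK), hi j hj], by rwa [constTail_of_lt _ hiK]⟩)
  have h₁ := hν.strCDF_constTail_top y K
  have h₂ := strCDF_mono (ν := ν) hle
  have h₃ := prefixProb_pos M y K
  rw [e] at h₁
  linarith

/-- The two neighbours `w₁ ⋯ w_k a (b-1) (b-1) ⋯` and `w₁ ⋯ w_k (a+1) 0 0 ⋯` have the same value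
under the distribution function, and the quantile function takes the larger one there. -/
theorem IsLaw.strQuantile_strCDF_maxBelow (w : Str b) (k : ℕ) {a a' : Fin b}
    (ha : (a' : ℕ) = a + 1) :
    strQuantile ν id (strCDF ν id (maxBelow w k a)) = minAbove w k a' := by
  have : IsLUB {v : Lex (Str b) | strCDF ν id (ofLex v) ≤ strCDF ν id (maxBelow w k a)}
      (toLex (minAbove w k a')) := by
    refine IsGreatest.isLUB ⟨(hν.strCDF_minAbove w k ha).le, fun v hv => ?_⟩
    by_contra! h
    have h₁ := hν.strCDF_minAbove_lt (x := ofLex v) h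
    rw [hν.strCDF_minAbove w k ha] at h₁
    exact h₁.not_ge hv
  rw [strQuantile, this.sSup_eq]
  rfl

end Law

/-! ### Càdlàg paths -/

theorem tendsto_m [NeZero b] (M : MarkovSource b) {α : Type*} {l : Filter α} {f : α → Str b}
    {y : Str b} (h : ∀ k, ∀ᶠ s in l, f s ∈ PiNat.cylinder y k) :
    Tendsto (fun s => M.m (f s)) l (𝓝 (M.m y)) := by
  obtain ⟨q, hq0, hq1, hq⟩ := exists_prefixProb_le_pow M
  rw [Metric.tendsto_nhds]
  intro ε hε
  have : Tendsto (fun k : ℕ => q ^ k / (1 - q)) atTop (𝓝 0) := by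
    simpa using (tendsto_pow_atTop_nhds_zero_of_lt_one hq0.le hq1).div_const (1 - q)
  obtain ⟨k, hk⟩ := (this.eventually (gt_mem_nhds hε)).exists
  filter_upwards [h k] with s hs
  exact (abs_m_sub_m_le hq0 hq1 hq hs).trans_lt hk

theorem exists_eventually_eq_nhdsLT {f : ℝ → Fin b} {t : ℝ} {s₀ : ℝ} (hs₀ : s₀ < t)
    (hf : MonotoneOn f (Set.Ioo s₀ t)) : ∃ c, ∀ᶠ s in 𝓝[<] t, f s = c := by
  obtain ⟨c, ⟨s₁, hs₁, rfl⟩, hmax⟩ := Set.exists_max_image (f '' Set.Ioo s₀ t) id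
    (Set.toFinite _) ((Set.nonempty_Ioo.2 hs₀).image f)
  refine ⟨f s₁, ?_⟩
  filter_upwards [Ioo_mem_nhdsLT hs₁.2] with s hs
  have hs' : s ∈ Set.Ioo s₀ t := ⟨hs₁.1.trans hs.1, hs.2⟩
  exact le_antisymm (hmax _ ⟨s, hs', rfl⟩) (hf hs₁ hs' hs.1.le)

/-- A monotone function with values in the strings has left limits for the product topology. -/
theorem exists_leftLim_of_monotone {H : ℝ → Str b} (hH : Monotone fun t => toLex (H t)) (t : ℝ) :
    ∃ y : Str b, ∀ k, ∀ᶠ s in 𝓝[<] t, H s ∈ PiNat.cylinder y k := by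
  have : Nonempty (Fin b) := ⟨H t 0⟩
  have key : ∀ l, ∃ c, ∀ᶠ s in 𝓝[<] t, H s l = c := by
    intro l
    induction l using Nat.strong_induction_on with
    | _ l ih =>
      choose! c hc using ih
      have hall : ∀ᶠ s in 𝓝[<] t, ∀ j ∈ Set.Iio l, H s j = c j :=
        (eventually_all_finite (Set.finite_Iio l)).2 hc
      obtain ⟨s₀, hs₀, hsub⟩ := (mem_nhdsLT_iff_exists_Ioo_subset).1 hall
      refine exists_eventually_eq_nhdsLT hs₀ fun s hs s' hs' hss' => ?_
      exact Pi.apply_le_of_toLex (hH hss') fun j hj => (hsub hs j hj).trans (hsub hs' j hj).symm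
  choose y hy using key
  exact ⟨y, fun k => (eventually_all_finite (Set.finite_Iio k)).2 fun l _ => hy l⟩

section Quantile

variable [NeZero b] {M : MarkovSource b} {ν : Measure (Str b)} [IsProbabilityMeasure ν]

omit [IsProbabilityMeasure ν] in
theorem strQuantile_mono : Monotone fun t => toLex (strQuantile ν id t) :=
  fun _ _ hst => sSup_le_sSup fun _ hv => le_trans (α := ℝ) hv hst

omit [IsProbabilityMeasure ν] in
theorem le_strQuantile {w : Str b} {t : ℝ} (h : strCDF ν id w ≤ t) :
    toLex w ≤ toLex (strQuantile ν id t) :=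
  le_sSup (α := Lex (Str b)) h

theorem strQuantile_le {w : Str b} {t : ℝ} (h : t < strCDF ν id w) :
    toLex (strQuantile ν id t) ≤ toLex w := by
  refine sSup_le (α := Lex (Str b)) fun v hv => ?_
  by_contra! hlt
  exact (h.trans_le (strCDF_mono (x := ofLex v) hlt.le)).not_ge hv

/-- Unless the quantile is the smallest string of all long cylinders around it, its
distribution function does not exceed `t`: the supremum is approached from below. -/
theorem IsLaw.strCDF_strQuantile_le (hν : IsLaw M ν) {t : ℝ}
    (h : ∀ᶠ n in atTop,
      toLex (constTail (strQuantile ν id t) n ⊥) < toLex (strQuantile ν id t)) :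
    strCDF ν id (strQuantile ν id t) ≤ t := by
  obtain ⟨q, hq0, hq1, hq⟩ := exists_prefixProb_le_pow M
  set w := strQuantile ν id t with hw
  have hlim : Tendsto (fun n : ℕ => t + q ^ n) atTop (𝓝 (t + 0)) :=
    (tendsto_pow_atTop_nhds_zero_of_lt_one hq0.le hq1).const_add t
  rw [add_zero] at hlim
  refine ge_of_tendsto hlim ?_
  filter_upwards [h] with n hn
  obtain ⟨v, hv, hlt⟩ := (lt_sSup_iff (α := Lex (Str b))).1 hn
  have h₁ : strCDF ν id w ≤ strCDF ν id (constTail w n ⊤) := strCDF_mono (le_constTail_top w n)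
  have h₂ : strCDF ν id (constTail w n ⊥) ≤ strCDF ν id (ofLex v) :=
    strCDF_mono (x := ofLex v) hlt.le
  have h₃ := hν.strCDF_constTail_top w n
  have h₄ := hq w n
  have h₅ : strCDF ν id (ofLex v) ≤ t := hv
  linarith

/-- The quantile function is right-continuous for the product topology on strings. -/
theorem IsLaw.strQuantile_eventually_mem_cylinder (hν : IsLaw M ν) (hb : 2 ≤ b) (t : ℝ) (k : ℕ) :
    ∀ᶠ s in 𝓝[>] t, strQuantile ν id s ∈ PiNat.cylinder (strQuantile ν id t) k := by
  set w := strQuantile ν id t with hw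
  have hwle : ∀ s, t < s → toLex w ≤ toLex (strQuantile ν id s) :=
    fun s hs => strQuantile_mono hs.le
  rcases lt_or_eq_of_le (le_constTail_top w k) with hlt | heq
  · have ht : t < strCDF ν id (constTail w k ⊤) := by
      by_contra! h
      exact (le_strQuantile h).not_gt hlt
    filter_upwards [Ioo_mem_nhdsGT ht] with s hs
    exact mem_cylinder_iff_toLex.2
      ⟨(constTail_bot_le w k).trans (hwle s hs.1), strQuantile_le hs.2⟩
  · have hex : ∃ n, ∀ l ≥ n, w l = ⊤ :=
      ⟨k, fun l hl => (congrFun (toLex_inj.1 heq) l).trans (constTail_of_le _ hl)⟩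
    classical
    obtain ⟨n, hn, hmin⟩ : ∃ n, (∀ l ≥ n, w l = ⊤) ∧ ∀ n' < n, ¬ ∀ l ≥ n', w l = ⊤ :=
      ⟨Nat.find hex, Nat.find_spec hex, fun n' hn' => Nat.find_min hex hn'⟩
    cases n with
    | zero =>
      filter_upwards [self_mem_nhdsWithin] with s hs
      have hle : toLex (strQuantile ν id s) ≤ toLex w := by
        refine (le_constTail_top _ 0).trans_eq (congrArg toLex ?_)
        ext1 l
        rw [hn l (Nat.zero_le l), constTail_of_le _ (Nat.zero_le l)]
      rw [← toLex_inj.1 (le_antisymm (hwle s hs) hle)]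
      exact PiNat.self_mem_cylinder w k
    | succ n =>
      -- `w` has a successor, with the same value of the distribution function: a contradiction
      exfalso
      have hne : w n ≠ ⊤ := fun h => hmin n n.lt_succ_self fun l hl => by
        rcases eq_or_lt_of_le hl with rfl | hl
        · exact h
        · exact hn l hl
      have hlt : (w n : ℕ) + 1 < b := by
        have h₁ : w n < ⊤ := lt_top_iff_ne_top.2 hne
        have h₂ := (⊤ : Fin b).isLt
        rw [Fin.lt_def] at h₁
        omega
      have hmax : maxBelow w n (w n) = w := by
        ext1 l
        rw [maxBelow_apply]
        split_ifs with h₁ h₂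
        · rfl
        · rw [h₂]
        · exact (hn l (by omega)).symm
      have hbt : (⊥ : Fin b) < ⊤ := by
        have : Nontrivial (Fin b) := Fin.nontrivial_iff_two_le.2 hb
        exact bot_lt_top
      have hF : strCDF ν id w ≤ t := by
        refine hν.strCDF_strQuantile_le ?_
        filter_upwards [eventually_ge_atTop (n + 1)] with j hj
        refine toLex_lt_iff.2 ⟨j, fun i hi => constTail_of_lt _ hi, ?_⟩
        rw [constTail_of_le _ le_rfl, ← hw, hn j hj]
        exact hbt
      have h₁ := maxBelow_lt_minAbove w n (a := w n) (a' := ⟨w n + 1, hlt⟩)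
        (by rw [Fin.lt_def]; simp)
      have h₂ := hν.strCDF_minAbove w n (a := w n) (a' := ⟨w n + 1, hlt⟩) rfl
      rw [hmax] at h₁ h₂
      exact (le_strQuantile (h₂.le.trans hF)).not_gt h₁

theorem IsLaw.isCadlag_m_strQuantile (hν : IsLaw M ν) (hb : 2 ≤ b) :
    IsCadlag fun t => M.m (strQuantile ν id t) := by
  intro t
  refine ⟨tendsto_m M (hν.strQuantile_eventually_mem_cylinder hb t), ?_⟩
  obtain ⟨y, hy⟩ := exists_leftLim_of_monotone strQuantile_mono t (H := strQuantile ν id)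
  exact ⟨_, tendsto_m M hy⟩

end Quantile

theorem isCadlag_comp_floor (a : ℕ → ℝ) {n : ℕ} (hn : 1 ≤ n) :
    IsCadlag fun t : ℝ => a ⌊t * n⌋₊ := by
  have hn' : (0 : ℝ) < n := by exact_mod_cast hn
  intro t
  have hcont : Tendsto (fun s : ℝ => s * n) (𝓝 t) (𝓝 (t * n)) :=
    (continuous_id.mul continuous_const).tendsto t
  simp only [← Int.floor_toNat]
  constructor
  · have h₁ : Tendsto (fun s : ℝ => s * n) (𝓝[>] t) (𝓝[≥] (t * n)) :=
      tendsto_nhdsWithin_iff.2 ⟨hcont.mono_left nhdsWithin_le_nhds, by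
        filter_upwards [self_mem_nhdsWithin] with s hs
        exact mul_le_mul_of_nonneg_right (le_of_lt hs) hn'.le⟩
    have h₂ := tendsto_pure.1 ((tendsto_floor_right_pure_floor (t * n)).comp h₁)
    refine tendsto_const_nhds.congr' ?_
    filter_upwards [h₂] with s hs
    rw [← hs]; rfl
  · have h₁ : Tendsto (fun s : ℝ => s * n) (𝓝[<] t) (𝓝[<] (t * n)) :=
      tendsto_nhdsWithin_iff.2 ⟨hcont.mono_left nhdsWithin_le_nhds, by
        filter_upwards [self_mem_nhdsWithin] with s hs
        exact mul_lt_mul_of_pos_right hs hn'⟩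
    have h₂ := tendsto_pure.1 ((tendsto_floor_left_pure_ceil_sub_one (t * n)).comp h₁)
    refine ⟨a (⌈t * n⌉ - 1).toNat, tendsto_const_nhds.congr' ?_⟩
    filter_upwards [h₂] with s hs
    rw [← hs]; rfl

theorem isCadlag_restrict {f : ℝ → ℝ} (hf : IsCadlag f) (u v : ℝ) :
    IsCadlag fun t : Set.Icc u v => f t := by
  intro t
  have hc : Tendsto (Subtype.val : Set.Icc u v → ℝ) (𝓝 t) (𝓝 (t : ℝ)) :=
    continuous_subtype_val.tendsto t
  have hR : Tendsto (Subtype.val : Set.Icc u v → ℝ) (𝓝[>] t) (𝓝[>] (t : ℝ)) :=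
    tendsto_nhdsWithin_iff.2 ⟨hc.mono_left nhdsWithin_le_nhds, by
      filter_upwards [self_mem_nhdsWithin] with s hs using hs⟩
  have hL : Tendsto (Subtype.val : Set.Icc u v → ℝ) (𝓝[<] t) (𝓝[<] (t : ℝ)) :=
    tendsto_nhdsWithin_iff.2 ⟨hc.mono_left nhdsWithin_le_nhds, by
      filter_upwards [self_mem_nhdsWithin] with s hs using hs⟩
  obtain ⟨h, l, hl⟩ := hf t
  exact ⟨h.comp hR, l, hl.comp hL⟩

/-- A step function with jumps at multiples of `1 / n`, centred by `n • (m ∘ h)` and normalized by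
`√n`. The paths of `𝒴_n` are of this form. -/
def stepPath [NeZero b] (M : MarkovSource b) (ν : Measure (Str b)) (n : ℕ) (a : ℕ → ℝ) (t : ℝ) :
    ℝ :=
  (a (⌊t * n⌋₊ + 1) - M.m (strQuantile ν id t) * n) / √(n : ℝ)

theorem IsLaw.isCadlag_stepPath [NeZero b] {M : MarkovSource b} {ν : Measure (Str b)}
    [IsProbabilityMeasure ν] (hν : IsLaw M ν) (hb : 2 ≤ b) {n : ℕ} (hn : 1 ≤ n) (a : ℕ → ℝ) :
    IsCadlag (stepPath M ν n a) := by
  intro t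
  obtain ⟨h₁, l₁, h₁'⟩ := isCadlag_comp_floor (fun k => a (k + 1)) hn t
  obtain ⟨h₂, l₂, h₂'⟩ := hν.isCadlag_m_strQuantile hb t
  exact ⟨(h₁.sub (h₂.mul_const _)).div_const _, _, (h₁'.sub (h₂'.mul_const _)).div_const _⟩

theorem normProc_eq_stepPath [NeZero b] (M : MarkovSource b) {Ω : Type*} [MeasurableSpace Ω]
    (P : Measure Ω) {S : ℕ → Ω → Str b} (hS : Measurable (S 0)) (n : ℕ) (t : ℝ) (ω : Ω) :
    normProc M P S n t ω =
      stepPath M (P.map (S 0)) n (radixCost (fun i => S i ω) n) t := by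
  rw [normProc, stepPath, strQuantile_eq_map P hS]

/-! ### Jumps of `m ∘ h` -/

section Cylinder

variable [NeZero b] {M : MarkovSource b} {ν : Measure (Str b)} [IsProbabilityMeasure ν]

theorem minAbove_bot (w : Str b) (k : ℕ) : minAbove w k ⊥ = constTail w k ⊥ := by
  ext1 l
  rw [minAbove_apply, constTail]
  split_ifs <;> rfl

theorem maxBelow_top (w : Str b) (k : ℕ) : maxBelow w k ⊤ = constTail w k ⊤ := by
  ext1 l
  rw [maxBelow_apply, constTail]
  split_ifs <;> rfl

/-- Every level in `[0, 1]` is met by the distribution function on some cylinder of any given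
length. -/
theorem IsLaw.exists_strCDF_constTail_le (hν : IsLaw M ν) {t : ℝ} (h0 : 0 ≤ t) (h1 : t ≤ 1)
    (k : ℕ) :
    ∃ w, strCDF ν id (constTail w k ⊥) ≤ t ∧ t ≤ strCDF ν id (constTail w k ⊤) := by
  induction k with
  | zero =>
    refine ⟨fun _ => ⊥, ?_⟩
    have h := hν.strCDF_constTail_top (fun _ => ⊥) 0
    have h₁ : strCDF ν id (constTail (fun _ => ⊥) 0 ⊤) ≤ 1 := measureReal_le_one
    have h₂ : 0 ≤ strCDF ν id (constTail (fun _ => ⊥) 0 ⊥) := measureReal_nonneg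
    simp only [MarkovSource.prefixProb] at h
    constructor <;> linarith
  | succ k ih =>
    obtain ⟨w, hw₁, hw₂⟩ := ih
    obtain ⟨a, ha, hmax⟩ := Set.exists_max_image {a | strCDF ν id (minAbove w k a) ≤ t} id
      (Set.toFinite _) ⟨⊥, by rw [Set.mem_ofPred_eq, minAbove_bot]; exact hw₁⟩
    refine ⟨Function.update w k a, ha, ?_⟩
    change t ≤ strCDF ν id (maxBelow w k a)
    by_cases hlt : (a : ℕ) + 1 < b
    · rw [← hν.strCDF_minAbove w k (a := a) (a' := ⟨a + 1, hlt⟩) rfl]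
      by_contra! h
      have h' : (⟨a + 1, hlt⟩ : Fin b) ≤ a := hmax _ h.le
      rw [Fin.le_def] at h'
      simp at h'
    · have : a = ⊤ := top_unique (by
        have h₂ := (⊤ : Fin b).isLt
        rw [Fin.le_def]; omega)
      rw [this, maxBelow_top]
      exact hw₂

/-- Some cylinder is mapped by the distribution function into a given open interval. -/
theorem IsLaw.exists_cylinder_strCDF_mem_Ioo (hν : IsLaw M ν) {u v : ℝ} (hu : 0 ≤ u)
    (huv : u < v) (hv : v ≤ 1) :
    ∃ w k, ∀ x ∈ PiNat.cylinder w k, strCDF ν id x ∈ Set.Ioo u v := by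
  obtain ⟨q, hq0, hq1, hq⟩ := exists_prefixProb_le_pow M
  obtain ⟨k, hk⟩ := exists_pow_lt_of_lt_one (show 0 < (v - u) / 2 by linarith) hq1
  obtain ⟨w, hw₁, hw₂⟩ := hν.exists_strCDF_constTail_le (t := (u + v) / 2) (by linarith)
    (by linarith) k
  refine ⟨w, k, fun x hx => ?_⟩
  obtain ⟨hx₁, hx₂⟩ := mem_cylinder_iff_toLex.1 hx
  have h := hν.strCDF_constTail_top w k
  have h₁ := strCDF_mono (ν := ν) hx₁
  have h₂ := strCDF_mono (ν := ν) hx₂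
  have h₃ := hq w k
  constructor <;> linarith

end Cylinder

theorem prefixProb_add_two (M : MarkovSource b) (x : Str b) (j : ℕ) :
    M.prefixProb x (j + 2) = M.prefixProb x (j + 1) * M.trans (x j) (x (j + 1)) := by
  simp only [MarkovSource.prefixProb]
  rw [Finset.prod_range_succ, mul_assoc]

/-- The value of `m` at a string that is eventually constant. -/
theorem m_of_eventually_const [NeZero b] (M : MarkovSource b) {x : Str b} {k : ℕ} {c : Fin b}
    (hx : ∀ l ≥ k + 2, x l = c) :
    M.m x = ∑ j ∈ Finset.range (k + 2), M.prefixProb x j +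
      M.prefixProb x (k + 1) * (M.trans (x k) (x (k + 1)) *
        (1 + M.trans (x (k + 1)) c / (1 - M.trans c c))) := by
  obtain ⟨q, hq0, hq1, hq⟩ := exists_prefixProb_le_pow M
  have htail : ∀ n, M.prefixProb x (n + (k + 3)) =
      M.prefixProb x (k + 2) * M.trans (x (k + 1)) c * M.trans c c ^ n := by
    intro n
    induction n with
    | zero =>
      rw [zero_add, prefixProb_add_two M x (k + 1), hx (k + 1 + 1) (by omega), pow_zero, mul_one]
    | succ n ih =>
      rw [show n + 1 + (k + 3) = (n + k + 2) + 2 by ring, prefixProb_add_two,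
        hx _ (by omega), hx _ (by omega), show n + k + 2 + 1 = n + (k + 3) by ring, ih, pow_succ]
      ring
  rw [MarkovSource.m, ← (summable_prefixProb hq0 hq1 hq x).sum_add_tsum_nat_add (k + 3),
    tsum_congr htail, tsum_mul_left,
    tsum_geometric_of_lt_one (M.trans_pos c c).le (M.trans_lt_one c c), Finset.sum_range_succ,
    prefixProb_add_two]
  ring

/-- If the values of `m` at two neighbouring strings agree, so do the weighted transition
probabilities into the symbols at which the strings split. -/
theorem trans_mul_eq_of_m_eq [NeZero b] (M : MarkovSource b) {w : Str b} {k : ℕ} {a a' : Fin b}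
    (h : M.m (maxBelow w (k + 1) a) = M.m (minAbove w (k + 1) a')) :
    M.trans (w k) a * (1 + M.trans a ⊤ / (1 - M.trans ⊤ ⊤)) =
      M.trans (w k) a' * (1 + M.trans a' ⊥ / (1 - M.trans ⊥ ⊥)) := by
  rw [m_of_eventually_const M (x := maxBelow w (k + 1) a) (k := k) (c := ⊤)
      (fun l hl => by rw [maxBelow_apply, if_neg (by omega), if_neg (by omega)]),
    m_of_eventually_const M (x := minAbove w (k + 1) a') (k := k) (c := ⊥)
      (fun l hl => by rw [minAbove_apply, if_neg (by omega), if_neg (by omega)])] at h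
  have e : ∀ j ≤ k + 1,
      M.prefixProb (maxBelow w (k + 1) a) j = M.prefixProb (minAbove w (k + 1) a') j := by
    intro j hj
    refine prefixProb_congr M fun l hl => ?_
    rw [maxBelow_apply, minAbove_apply, if_pos (by omega), if_pos (by omega)]
  rw [Finset.sum_congr rfl fun j hj => e j (by rw [Finset.mem_range] at hj; omega),
    e (k + 1) le_rfl] at h
  have h' := mul_left_cancel₀ (prefixProb_pos M _ _).ne' (add_left_cancel h)
  simpa [maxBelow_apply, minAbove_apply] using h'

/-- The rigidity behind the geometric weights: proportional consecutive columns force all rows of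
the transition matrix to agree, and then to be geometric. -/
theorem exists_trans_eq_geomWeight [NeZero b] (M : MarkovSource b)
    (h : ∀ i a a' : Fin b, (a' : ℕ) = a + 1 →
      M.trans i a * (1 + M.trans a ⊤ / (1 - M.trans ⊤ ⊤)) =
        M.trans i a' * (1 + M.trans a' ⊥ / (1 - M.trans ⊥ ⊥))) :
    ∃ β : ℝ, 0 < β ∧ ∀ i r : Fin b, M.trans i r = geomWeight b β r := by
  have hpos : ∀ a c, 0 < 1 + M.trans a c / (1 - M.trans c c) := fun a c =>
    add_pos one_pos (div_pos (M.trans_pos _ _) (sub_pos.2 (M.trans_lt_one _ _)))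
  -- any two rows are proportional
  have hprop : ∀ i i' (n : ℕ) (hn : n < b),
      M.trans i ⟨n, hn⟩ * M.trans i' ⊥ = M.trans i' ⟨n, hn⟩ * M.trans i ⊥ := by
    intro i i' n
    induction n with
    | zero =>
      intro hn
      rw [show (⟨0, hn⟩ : Fin b) = ⊥ from (bot_unique (Fin.le_def.2 (Nat.zero_le _)))]
      ring
    | succ n ih =>
      intro hn
      have h₀ := ih (by omega)
      have h₁ := h i ⟨n, by omega⟩ ⟨n + 1, hn⟩ rfl
      have h₂ := h i' ⟨n, by omega⟩ ⟨n + 1, hn⟩ rfl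
      refine mul_right_cancel₀ (hpos ⟨n + 1, hn⟩ ⊥).ne' ?_
      linear_combination (1 + M.trans ⟨n, by omega⟩ ⊤ / (1 - M.trans ⊤ ⊤)) * h₀ -
        M.trans i' ⊥ * h₁ + M.trans i ⊥ * h₂
  have hbot : ∀ i i', M.trans i' ⊥ = M.trans i ⊥ := by
    intro i i'
    have hs : ∑ a, M.trans i a * M.trans i' ⊥ = ∑ a, M.trans i' a * M.trans i ⊥ :=
      Finset.sum_congr rfl fun a _ => hprop i i' a a.isLt
    rwa [← Finset.sum_mul, ← Finset.sum_mul, M.trans_sum, M.trans_sum, one_mul, one_mul] at hs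
  have hrow : ∀ i a, M.trans i a = M.trans ⊥ a := fun i a => by
    have h₁ := hprop i ⊥ a a.isLt
    rw [hbot i ⊥] at h₁
    exact mul_right_cancel₀ (M.trans_pos i ⊥).ne' h₁
  set p : Fin b → ℝ := M.trans ⊥ with hp
  have hp1 : ∀ c, 0 < 1 - p c := fun c => sub_pos.2 (M.trans_lt_one _ _)
  set β : ℝ := (1 - p ⊥) / (1 - p ⊤) with hβ
  have hβ0 : 0 < β := div_pos (hp1 _) (hp1 _)
  have hgeom : ∀ (n : ℕ) (hn : n < b), p ⟨n, hn⟩ = p ⊥ * β ^ n := by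
    intro n
    induction n with
    | zero =>
      intro hn
      rw [show (⟨0, hn⟩ : Fin b) = ⊥ from (bot_unique (Fin.le_def.2 (Nat.zero_le _)))]
      ring
    | succ n ih =>
      intro hn
      have h₁ := h ⊥ ⟨n, by omega⟩ ⟨n + 1, hn⟩ rfl
      rw [hrow ⟨n, _⟩, hrow ⟨n + 1, _⟩, hrow ⊤, ← hp, ih] at h₁
      have hT := (hp1 ⊤).ne'
      have hB := (hp1 ⊥).ne'
      rw [pow_succ, ← mul_assoc]
      have e₁ : 1 + p ⊤ / (1 - p ⊤) = 1 / (1 - p ⊤) := by field_simp; ring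
      have e₂ : 1 + p ⊥ / (1 - p ⊥) = 1 / (1 - p ⊥) := by field_simp; ring
      rw [e₁, e₂] at h₁
      have e₃ : β * (1 - p ⊤) = 1 - p ⊥ := div_mul_cancel₀ _ hT
      field_simp at h₁
      refine mul_right_cancel₀ hT ?_
      linear_combination (-1) * h₁ - p ⊥ * β ^ n * e₃
  refine ⟨β, hβ0, fun i r => ?_⟩
  have hsum : p ⊥ * ∑ n ∈ Finset.range b, β ^ n = 1 := by
    rw [← M.trans_sum ⊥, Finset.mul_sum, ← Fin.sum_univ_eq_sum_range fun n => p ⊥ * β ^ n]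
    exact Finset.sum_congr rfl fun a _ => (hgeom a a.isLt).symm
  rw [hrow, show p r = p ⊥ * β ^ (r : ℕ) from hgeom r r.isLt, geomWeight]
  split_ifs with h1
  · rw [h1] at hsum ⊢
    simp only [one_pow, Finset.sum_const, Finset.card_range, nsmul_eq_mul, mul_one] at hsum ⊢
    exact eq_one_div_of_mul_eq_one_left hsum
  · congr 1
    have h2 : ∑ n ∈ Finset.range b, β ^ n ≠ 0 := fun h0 => by simp [h0] at hsum
    rw [← mul_neg_geom_sum β b, eq_div_iff (mul_ne_zero (sub_ne_zero.2 (Ne.symm h1)) h2)]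
    linear_combination (1 - β) * hsum

/-- Unless the transition probabilities are geometric weights, `m ∘ h` has jumps in every interval:
there are two neighbouring strings with different values of `m`. -/
theorem IsLaw.exists_m_maxBelow_ne [NeZero b] {M : MarkovSource b} {ν : Measure (Str b)}
    [IsProbabilityMeasure ν] (hν : IsLaw M ν)
    (hM : ¬ ∃ β : ℝ, 0 < β ∧ ∀ i r : Fin b, M.trans i r = geomWeight b β r)
    {u v : ℝ} (hu : 0 ≤ u) (huv : u < v) (hv : v ≤ 1) :
    ∃ (w : Str b) (k : ℕ) (a a' : Fin b), (a' : ℕ) = a + 1 ∧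
      strCDF ν id (maxBelow w k a) ∈ Set.Ioo u v ∧
      M.m (maxBelow w k a) ≠ M.m (minAbove w k a') := by
  obtain ⟨w, k, hwk⟩ := hν.exists_cylinder_strCDF_mem_Ioo hu huv hv
  by_contra! hcon
  refine hM (exists_trans_eq_geomWeight M fun i a a' ha => ?_)
  have h := hcon (Function.update w k i) (k + 1) a a' ha (hwk _ fun l hl => by
    rw [maxBelow_apply, if_pos (by omega), Function.update_of_ne (by omega)])
  simpa using trans_mul_eq_of_m_eq M h

/-! ### Measurability -/

section Measurability

variable {Ω : Type*} [MeasurableSpace Ω] {S : ℕ → Ω → Str b}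

theorem measurable_prefixCount (hS : ∀ i, Measurable (S i)) {f : Ω → Str b} (hf : Measurable f)
    (n k : ℕ) : Measurable fun ω => prefixCount (fun i => S i ω) n k (f ω) := by
  simp only [prefixCount, Finset.card_filter]
  exact Finset.measurable_sum _ fun i _ =>
    Measurable.ite (measurableSet_agree (hS i) hf k) measurable_const measurable_const

theorem measurable_pathCost (hS : ∀ i, Measurable (S i)) {f : Ω → Str b} (hf : Measurable f)
    (n : ℕ) : Measurable fun ω => pathCost (fun i => S i ω) n (f ω) := by
  -- summation in `[0, ∞]` gives the same value, also for divergent series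
  have : (fun ω => pathCost (fun i => S i ω) n (f ω)) = fun ω =>
      (∑' k, if 1 < prefixCount (fun i => S i ω) n k (f ω) then
        (prefixCount (fun i => S i ω) n k (f ω) : ENNReal) else 0).toReal := by
    ext ω
    rw [ENNReal.tsum_toReal_eq fun k => by split_ifs <;> simp]
    exact tsum_congr fun k => by split_ifs <;> simp
  rw [this]
  refine (Measurable.tsum fun k => ?_).ennreal_toReal
  have h := measurable_prefixCount hS hf n k
  exact Measurable.ite (measurableSet_lt measurable_const h)
    ((measurable_of_countable _).comp h) measurable_const

theorem measurable_orderStat (hS : ∀ i, Measurable (S i)) (n l : ℕ) :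
    Measurable fun ω => orderStat (fun i => S i ω) n l := by
  by_cases hl : 1 ≤ l ∧ l ≤ n
  · simp only [orderStat, dif_pos hl]
    intro A hA
    have hsort : ∀ σ : Equiv.Perm (Fin n),
        MeasurableSet {ω | σ = Tuple.sort fun i : Fin n => toLex (S i ω)} := by
      intro σ
      have : {ω | σ = Tuple.sort fun i : Fin n => toLex (S i ω)} =
          (⋂ i, ⋂ j, ⋂ (_ : i ≤ j), {ω | toLex (S (σ i) ω) ≤ toLex (S (σ j) ω)}) ∩
          ⋂ i, ⋂ j, ⋂ (_ : i < j), ({ω | S (σ i) ω = S (σ j) ω}ᶜ ∪ {_ω | σ i < σ j}) := by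
        ext ω
        simp only [Set.mem_ofPred_eq, Tuple.eq_sort_iff, Set.mem_inter_iff, Set.mem_iInter,
          Set.mem_union, Set.mem_compl_iff, Monotone, Function.comp, toLex_inj,
          ← imp_iff_not_or]
      rw [this]
      refine .inter (.iInter fun i => .iInter fun j => .iInter fun _ =>
        measurableSet_toLex_le (hS _) (hS _)) (.iInter fun i => .iInter fun j => .iInter fun _ =>
        .union (MeasurableSet.compl ?_) (.const _))
      have : {ω | S (σ i) ω = S (σ j) ω} = ⋂ l, {ω | S (σ i) ω l = S (σ j) ω l} := by
        ext ω
        simp [funext_iff]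
      rw [this]
      exact .iInter fun l => measurableSet_eq_fun
        (measurable_pi_iff.1 (hS _) l) (measurable_pi_iff.1 (hS _) l)
    have : (fun ω => S (Tuple.sort (fun i : Fin n => toLex (S i ω)) ⟨l - 1, by omega⟩) ω) ⁻¹' A =
        ⋃ σ : Equiv.Perm (Fin n), {ω | σ = Tuple.sort fun i : Fin n => toLex (S i ω)} ∩
          S (σ ⟨l - 1, by omega⟩) ⁻¹' A := by
      ext ω
      simp only [Set.mem_preimage, Set.mem_iUnion, Set.mem_inter_iff, Set.mem_ofPred_eq]
      constructor
      · exact fun h => ⟨_, rfl, h⟩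
      · rintro ⟨σ, rfl, h⟩
        exact h
    rw [this]
    exact .iUnion fun σ => (hsort σ).inter (hS _ hA)
  · simp only [orderStat, dif_neg hl]
    exact hS 0

theorem measurable_radixCost (hS : ∀ i, Measurable (S i)) (n l : ℕ) :
    Measurable fun ω => radixCost (fun i => S i ω) n l :=
  measurable_pathCost hS (measurable_orderStat hS n _) n

theorem measurable_normProc [NeZero b] (M : MarkovSource b) (P : Measure Ω)
    (hS : ∀ i, Measurable (S i)) (n : ℕ) (t : ℝ) : Measurable (normProc M P S n t) :=
  ((measurable_radixCost hS n _).sub measurable_const).div_const _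

end Measurability

/-- The path with finitely many step heights, as an element of `D[u,v]`, depends continuously on
these heights. -/
theorem continuous_stepPath_skorokhod [NeZero b] {M : MarkovSource b} {ν : Measure (Str b)}
    [IsProbabilityMeasure ν] (hν : IsLaw M ν) (hb : 2 ≤ b) {n : ℕ} (hn : 1 ≤ n) (u v : ℝ) :
    Continuous fun a : Fin (n + 1) → ℝ =>
      (⟨fun t => stepPath M ν n (fun l => a ⟨min l n, by omega⟩) t,
        isCadlag_restrict (hν.isCadlag_stepPath hb hn _) u v⟩ : SkorokhodSpace u v) := by
  refine continuous_def.2 fun U hU => Metric.isOpen_iff.2 fun a ha => ?_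
  obtain ⟨ε, hε, hball⟩ := hU _ ha
  refine ⟨ε, hε, fun a' ha' => hball ⟨OrderIso.refl _, fun t => ⟨by simpa using hε, ?_⟩⟩⟩
  have h1 : 1 ≤ √(n : ℝ) := Real.one_le_sqrt.2 (by exact_mod_cast hn)
  simp only [stepPath, OrderIso.refl_apply]
  rw [← sub_div, sub_sub_sub_cancel_right, abs_div, abs_of_pos (one_pos.trans_le h1)]
  refine (div_le_self (abs_nonneg _) h1).trans_lt ?_
  rw [← Real.dist_eq]
  exact (dist_le_pi_dist a' a _).trans_lt (Metric.mem_ball.1 ha')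

/-- The normalized process is a random element of `D[u,v]`: a measurable vector of step heights,
followed by a continuous map. -/
theorem measurable_restrict_normProc [NeZero b] (M : MarkovSource b) {Ω : Type*}
    [MeasurableSpace Ω] (P : Measure Ω) [IsProbabilityMeasure P] {S : ℕ → Ω → Str b}
    (hS : ∀ i, Measurable (S i)) (hν : IsLaw M (P.map (S 0))) (hb : 2 ≤ b) {n : ℕ} (hn : 1 ≤ n)
    (u v : ℝ) :
    Measurable fun ω => SkorokhodSpace.restrict u v fun t => normProc M P S n t ω := by
  have : IsProbabilityMeasure (P.map (S 0)) := Measure.isProbabilityMeasure_map (hS 0).aemeasurable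
  have hmeas : Measurable fun ω => fun i : Fin (n + 1) => radixCost (fun i => S i ω) n i :=
    measurable_pi_lambda _ fun i => measurable_radixCost hS n i
  convert (continuous_stepPath_skorokhod hν hb hn u v).measurable.comp hmeas using 1
  ext1 ω
  have e : (fun t => normProc M P S n t ω) = stepPath M (P.map (S 0)) n
      fun l => radixCost (fun i => S i ω) n (min l n) := by
    ext t
    rw [normProc_eq_stepPath M P (hS 0)]
    simp only [stepPath, radixCost, min_assoc, min_self]
  rw [e, SkorokhodSpace.restrict, dif_pos (isCadlag_restrict (hν.isCadlag_stepPath hb hn _) u v)]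
  rfl

/-! ### Compact sets of the Skorokhod space -/

theorem exists_bound_of_isCadlag {u v : ℝ} {f : Set.Icc u v → ℝ} (hf : IsCadlag f) :
    ∃ r, ∀ t, |f t| ≤ r := by
  have hloc : ∀ t, ∃ r, ∀ᶠ s in 𝓝 t, |f s| ≤ r := by
    intro t
    obtain ⟨hR, l, hL⟩ := hf t
    have h₁ := hR.abs.eventually (ge_mem_nhds (lt_add_one |f t|))
    have h₂ := hL.abs.eventually (ge_mem_nhds (lt_add_one |l|))
    refine ⟨max (|f t| + 1) (|l| + 1), ?_⟩
    rw [← nhdsNE_sup_pure, ← nhdsLT_sup_nhdsGT, eventually_sup, eventually_sup]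
    exact ⟨⟨h₂.mono fun s hs => hs.trans (le_max_right _ _),
      h₁.mono fun s hs => hs.trans (le_max_left _ _)⟩,
      eventually_pure.2 ((lt_add_one _).le.trans (le_max_left _ _))⟩
  choose r hr using hloc
  obtain ⟨T, hT⟩ := CompactSpace.elim_nhds_subcover (fun t => {s | |f s| ≤ r t}) hr
  refine ⟨∑ t ∈ T, |r t|, fun s => ?_⟩
  have hs : s ∈ ⋃ t ∈ T, {s | |f s| ≤ r t} := by rw [hT]; trivial
  simp only [Set.mem_iUnion, Set.mem_ofPred_eq] at hs
  obtain ⟨t, ht, hst⟩ := hs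
  exact (hst.trans (le_abs_self _)).trans
    (Finset.single_le_sum (f := fun t => |r t|) (fun _ _ => abs_nonneg _) ht)

/-- The paths that are bounded by a constant smaller than `r`. -/
def boundedPaths (u v r : ℝ) : Set (SkorokhodSpace u v) := {f | ∃ r' < r, ∀ t, |f.toFun t| ≤ r'}

theorem isOpen_boundedPaths (u v r : ℝ) : IsOpen (boundedPaths u v r) := by
  rintro f ⟨r', hr', hf⟩
  refine ⟨(r - r') / 2, by linarith, ?_⟩
  rintro g ⟨τ, hτ⟩
  refine ⟨(r + r') / 2, by linarith, fun t => ?_⟩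
  have h₁ := (hτ (τ.symm t)).2
  rw [OrderIso.apply_symm_apply] at h₁
  have h₂ := hf (τ.symm t)
  have h₃ := abs_add_le (g.toFun t - f.toFun (τ.symm t)) (f.toFun (τ.symm t))
  rw [sub_add_cancel] at h₃
  linarith

/-- Compact sets of `D[u,v]` are bounded in supremum norm. -/
theorem exists_subset_boundedPaths {u v : ℝ} {K : Set (SkorokhodSpace u v)} (hK : IsCompact K) :
    ∃ r, K ⊆ boundedPaths u v r := by
  obtain ⟨n, hn⟩ := hK.elim_directed_cover (fun n : ℕ => boundedPaths u v n)
    (fun n => isOpen_boundedPaths u v n) (fun f _ => by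
      obtain ⟨r, hr⟩ := exists_bound_of_isCadlag f.cadlag
      obtain ⟨n, hn⟩ := exists_nat_gt r
      exact Set.mem_iUnion.2 ⟨n, r, hn, hr⟩)
    (directed_of_isDirected_le fun i j hij f ⟨r, hr, hf⟩ =>
      ⟨r, hr.trans_le (by exact_mod_cast hij), hf⟩)
  exact ⟨n, hn⟩

/-- A sequence of random elements of `D[u,v]` whose values at a fixed time are unbounded in
probability is not tight. -/
theorem not_isTightMeasureSet_skorokhod {u v : ℝ} {Ω : Type*} [MeasurableSpace Ω] {P : Measure Ω}
    {X : ℕ → Ω → SkorokhodSpace u v} (hX : ∀ n, 1 ≤ n → AEMeasurable (X n) P) (t : Set.Icc u v)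
    {c : ENNReal} (hc : 0 < c)
    (h : ∀ r : ℝ, ∃ n, 1 ≤ n ∧ c < P {ω | r < |(X n ω).toFun t|}) :
    ¬ IsTightMeasureSet {ν : Measure (SkorokhodSpace u v) | ∃ n : ℕ, 1 ≤ n ∧ ν = P.map (X n)} := by
  intro htight
  obtain ⟨K, hK, hle⟩ := isTightMeasureSet_iff_exists_isCompact_measure_compl_le.1 htight c hc
  obtain ⟨r, hr⟩ := exists_subset_boundedPaths hK
  obtain ⟨n, hn, hlt⟩ := h r
  refine (hle _ ⟨n, hn, rfl⟩).not_gt (hlt.trans_le ?_)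
  calc P {ω | r < |(X n ω).toFun t|} ≤ P (X n ⁻¹' (boundedPaths u v r)ᶜ) := by
        refine measure_mono fun ω hω => ?_
        rintro ⟨r', hr', hb⟩
        exact ((hb t).trans_lt hr').not_gt hω
    _ = P.map (X n) (boundedPaths u v r)ᶜ :=
        (Measure.map_apply_of_aemeasurable (hX n hn)
          (isOpen_boundedPaths u v r).measurableSet.compl).symm
    _ ≤ P.map (X n) Kᶜ := measure_mono (Set.compl_subset_compl.2 hr)

theorem not_isTightMeasureSet_real {Ω : Type*} [MeasurableSpace Ω] {P : Measure Ω}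
    {X : ℕ → Ω → ℝ} (hX : ∀ n, 1 ≤ n → AEMeasurable (X n) P)
    {c : ENNReal} (hc : 0 < c) (h : ∀ r : ℝ, ∃ n, 1 ≤ n ∧ c < P {ω | r < |X n ω|}) :
    ¬ IsTightMeasureSet {ν : Measure ℝ | ∃ n : ℕ, 1 ≤ n ∧ ν = P.map (X n)} := by
  intro htight
  obtain ⟨K, hK, hle⟩ := isTightMeasureSet_iff_exists_isCompact_measure_compl_le.1 htight c hc
  obtain ⟨r, hr⟩ := hK.isBounded.subset_closedBall 0
  obtain ⟨n, hn, hlt⟩ := h r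
  refine (hle _ ⟨n, hn, rfl⟩).not_gt (hlt.trans_le ?_)
  calc P {ω | r < |X n ω|} ≤ P (X n ⁻¹' (Metric.closedBall 0 r)ᶜ) := by
        refine measure_mono fun ω hω hb => ?_
        rw [mem_closedBall_zero_iff, Real.norm_eq_abs] at hb
        exact hb.not_gt hω
    _ = P.map (X n) (Metric.closedBall 0 r)ᶜ :=
        (Measure.map_apply_of_aemeasurable (hX n hn)
          Metric.isClosed_closedBall.measurableSet.compl).symm
    _ ≤ P.map (X n) Kᶜ := measure_mono (Set.compl_subset_compl.2 hr)

/-! ### Limit theorems for the number of strings in a set -/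

theorem isPiSystem_cylinder :
    IsPiSystem {s : Set (Str b) | ∃ w k, s = PiNat.cylinder w k} := by
  rintro _ ⟨w, k, rfl⟩ _ ⟨w', k', rfl⟩ ⟨x, hx, hx'⟩
  refine ⟨x, max k k', ?_⟩
  ext y
  constructor
  · rintro ⟨hy, hy'⟩ l hl
    rcases lt_max_iff.1 hl with h | h
    · rw [hy l h, hx l h]
    · rw [hy' l h, hx' l h]
  · intro hy
    exact ⟨fun l hl => (hy l (hl.trans_le (le_max_left _ _))).trans (hx l hl),
      fun l hl => (hy l (hl.trans_le (le_max_right _ _))).trans (hx' l hl)⟩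

theorem generateFrom_cylinder :
    (inferInstance : MeasurableSpace (Str b)) =
      MeasurableSpace.generateFrom {s : Set (Str b) | ∃ w k, s = PiNat.cylinder w k} := by
  refine le_antisymm (iSup_le fun i => ?_) (MeasurableSpace.generateFrom_le ?_)
  · rintro _ ⟨s, -, rfl⟩
    have : (fun x : Str b => x i) ⁻¹' s = ⋃ p : Fin (i + 1) → Fin b, ⋃ (_ : p (Fin.last i) ∈ s),
        PiNat.cylinder (fun l => p ⟨min l i, by omega⟩) (i + 1) := by
      ext x
      simp only [Set.mem_preimage, Set.mem_iUnion]
      constructor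
      · intro hx
        refine ⟨fun l => x l, hx, fun l hl => ?_⟩
        simp only
        rw [min_eq_left (by omega)]
      · rintro ⟨p, hp, hx⟩
        have := hx i i.lt_succ_self
        simp only [min_self] at this
        rw [this]
        exact hp
    rw [this]
    exact .iUnion fun p => .iUnion fun _ => MeasurableSpace.measurableSet_generateFrom ⟨_, _, rfl⟩
  · rintro _ ⟨w, k, rfl⟩
    exact measurableSet_cylinder w k

theorem IsLaw.eq {M : MarkovSource b} {ν ν' : Measure (Str b)} [IsProbabilityMeasure ν]
    [IsProbabilityMeasure ν'] (hν : IsLaw M ν) (hν' : IsLaw M ν') : ν = ν' :=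
  ext_of_generate_finite _ generateFrom_cylinder isPiSystem_cylinder
    (by rintro _ ⟨w, k, rfl⟩; rw [hν, hν']) (by simp)

section Sample

variable {M : MarkovSource b} {Ω : Type*} [MeasurableSpace Ω] {P : Measure Ω}
  {S : ℕ → Ω → Str b}

theorem isLaw_map (hS : IsMarkovSample M P S) (i : ℕ) : IsLaw M (P.map (S i)) := by
  intro w k
  rw [Measure.map_apply (hS.measurable i) (measurableSet_cylinder w k)]
  exact hS.prefix_law i w k

theorem map_eq_map [IsProbabilityMeasure P] (hS : IsMarkovSample M P S) (i : ℕ) :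
    P.map (S i) = P.map (S 0) := by
  have := Measure.isProbabilityMeasure_map (μ := P) (hS.measurable i).aemeasurable
  have := Measure.isProbabilityMeasure_map (μ := P) (hS.measurable 0).aemeasurable
  exact (isLaw_map hS i).eq (isLaw_map hS 0)

open Classical in
/-- The number of strings among the first `n` that lie in `A`. -/
def countIn (x : ℕ → Str b) (A : Set (Str b)) (n : ℕ) : ℕ :=
  ((Finset.range n).filter fun i => x i ∈ A).card

theorem prefixCount_eq_countIn (x : ℕ → Str b) (n k : ℕ) (w : Str b) :
    prefixCount x n k w = countIn x (PiNat.cylinder w k) n := by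
  classical
  rw [prefixCount, countIn]
  congr 1
  exact Finset.filter_congr fun _ _ => Iff.rfl

theorem countIn_eq_sum (x : ℕ → Str b) (A : Set (Str b)) (n : ℕ) :
    (countIn x A n : ℝ) = ∑ i ∈ Finset.range n, A.indicator (1 : Str b → ℝ) (x i) := by
  classical
  rw [countIn, Finset.card_filter]
  push_cast
  exact Finset.sum_congr rfl fun i _ => by simp [Set.indicator_apply]

section LimitTheorems

variable [IsProbabilityMeasure P] (hS : IsMarkovSample M P S) {A : Set (Str b)}
  (hA : MeasurableSet A)
include hS hA

omit [IsProbabilityMeasure P] in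
theorem iIndepFun_indicator :
    iIndepFun (fun i ω => A.indicator (1 : Str b → ℝ) (S i ω)) P :=
  hS.indep.comp (fun _ => A.indicator 1) fun _ => measurable_one.indicator hA

theorem identDistrib_indicator (i : ℕ) :
    IdentDistrib (fun ω => A.indicator (1 : Str b → ℝ) (S i ω))
      (fun ω => A.indicator (1 : Str b → ℝ) (S 0 ω)) P P :=
  IdentDistrib.comp ⟨(hS.measurable i).aemeasurable, (hS.measurable 0).aemeasurable,
    map_eq_map hS i⟩ (measurable_one.indicator hA)

omit [IsProbabilityMeasure P] in
theorem integral_indicator_sample :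
    ∫ ω, A.indicator (1 : Str b → ℝ) (S 0 ω) ∂P = (P.map (S 0)).real A := by
  rw [map_measureReal_apply (hS.measurable 0) hA,
    ← integral_indicator_one (hS.measurable 0 hA)]
  rfl

theorem memLp_indicator_sample :
    MemLp (fun ω => A.indicator (1 : Str b → ℝ) (S 0 ω)) 2 P := by
  refine MemLp.of_bound ((measurable_one.indicator hA).comp (hS.measurable 0)).aestronglyMeasurable
    1 (ae_of_all _ fun ω => ?_)
  by_cases h : S 0 ω ∈ A <;> simp [h]

/-- Weak law of large numbers for the number of strings in a set. -/
theorem tendsto_measure_countIn {ε : ℝ} (hε : 0 < ε) :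
    Tendsto (fun n : ℕ => P.real {ω | ε * n < |(countIn (fun i => S i ω) A n : ℝ) -
      n * (P.map (S 0)).real A|}) atTop (𝓝 0) := by
  have hslln := strong_law_ae_real (fun i ω => A.indicator (1 : Str b → ℝ) (S i ω))
    ((memLp_indicator_sample hS hA).integrable (by norm_num))
    (fun i j hij => (iIndepFun_indicator hS hA).indepFun hij) (identDistrib_indicator hS hA)
  rw [integral_indicator_sample hS hA] at hslln
  have hmeas : TendstoInMeasure P (fun (n : ℕ) ω =>
      (∑ i ∈ Finset.range n, A.indicator (1 : Str b → ℝ) (S i ω)) / (n : ℝ)) atTop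
      (fun _ => (P.map (S 0)).real A) := by
    refine tendstoInMeasure_of_tendsto_ae (fun n => ?_) hslln
    exact ((Finset.measurable_sum _ fun i _ =>
      (measurable_one.indicator hA).comp (hS.measurable i)).div_const _).aestronglyMeasurable
  have h := (ENNReal.tendsto_toReal ENNReal.zero_ne_top).comp
    (hmeas (ENNReal.ofReal ε) (ENNReal.ofReal_pos.2 hε))
  refine squeeze_zero' (Eventually.of_forall fun n => measureReal_nonneg) ?_ h
  filter_upwards [eventually_gt_atTop 0] with n hn
  have hn' : (0 : ℝ) < n := by exact_mod_cast hn
  refine measureReal_mono (fun ω hω => ?_) (measure_ne_top _ _)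
  rw [Set.mem_ofPred_eq] at hω ⊢
  rw [edist_dist, Real.dist_eq, ← countIn_eq_sum]
  refine ENNReal.ofReal_le_ofReal ?_
  rw [show (countIn (fun i => S i ω) A n : ℝ) / n - (P.map (S 0)).real A =
    (countIn (fun i => S i ω) A n - n * (P.map (S 0)).real A) / n by field_simp, abs_div,
    abs_of_pos hn', le_div_iff₀ hn']
  exact hω.le

/-- By the central limit theorem, the number of strings in a set exceeds its mean with
probability bounded away from zero. -/
theorem exists_eventually_le_measure_countIn (h0 : 0 < (P.map (S 0)).real A)
    (h1 : (P.map (S 0)).real A < 1) :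
    ∃ c : ℝ, 0 < c ∧ ∀ᶠ n : ℕ in atTop,
      c ≤ P.real {ω | n * (P.map (S 0)).real A < countIn (fun i => S i ω) A n} := by
  set p := (P.map (S 0)).real A with hp
  set X : ℕ → Ω → ℝ := fun i ω => A.indicator (1 : Str b → ℝ) (S i ω) with hX
  have hmean : P[X 0] = p := integral_indicator_sample hS hA
  have hvar : Var[X 0; P] = p * (1 - p) := by
    have hsq : X 0 ^ 2 = X 0 := by
      ext ω
      by_cases h : S 0 ω ∈ A <;> simp [hX, h]
    rw [variance_eq_sub (memLp_indicator_sample hS hA), hsq, hmean]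
    ring
  set s : NNReal := Var[X 0; P].toNNReal with hs
  have hs0 : s ≠ 0 := by
    rw [hs, hvar, ne_eq, Real.toNNReal_eq_zero, not_le]
    exact mul_pos h0 (sub_pos.2 h1)
  have hclt := tendstoInDistribution_inv_sqrt_mul_sum_sub (P := P) (X := X)
    (Y := (id : ℝ → ℝ)) (P' := gaussianReal 0 s) HasLaw.id
    (memLp_indicator_sample hS hA) (iIndepFun_indicator hS hA) (identDistrib_indicator hS hA)
  have hlim := ProbabilityMeasure.le_liminf_measure_open_of_tendsto hclt.tendsto
    (isOpen_Ioi (a := (0 : ℝ)))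
  have hpos : 0 < gaussianReal 0 s (Set.Ioi 0) := by
    rw [pos_iff_ne_zero]
    intro hzero
    have := gaussianReal_absolutelyContinuous' 0 hs0 hzero
    simp at this
  simp only [ProbabilityMeasure.coe_mk, Measure.map_id] at hlim
  obtain ⟨c, hc0, hc⟩ := exists_between hpos
  refine ⟨c.toReal, ENNReal.toReal_pos hc0.ne' hc.ne_top, ?_⟩
  filter_upwards [eventually_lt_of_lt_liminf (hc.trans_le hlim)] with n hn
  refine ENNReal.toReal_mono (measure_ne_top _ _) (hn.le.trans ?_)
  rw [Measure.map_apply_of_aemeasurable (hclt.forall_aemeasurable n) measurableSet_Ioi]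
  refine measure_mono fun ω hω => ?_
  have h' : 0 < (√(n : ℝ))⁻¹ * (∑ k ∈ Finset.range n, X k ω - n * P[X 0]) := hω
  have h := pos_of_mul_pos_right h' (inv_nonneg.2 (Real.sqrt_nonneg _))
  rw [hmean, ← countIn_eq_sum] at h
  exact sub_pos.1 h

end LimitTheorems

end Sample

/-! ### Ranks and the cost of deep levels -/

open Classical in
theorem card_sort_eq_countIn (x : ℕ → Str b) (n : ℕ) (A : Set (Str b))
    (σ : Equiv.Perm (Fin n)) :
    (Finset.univ.filter fun i : Fin n => x (σ i) ∈ A).card = countIn x A n := by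
  rw [countIn, Finset.card_filter, Finset.card_filter,
    Equiv.sum_comp σ fun i : Fin n => if x i ∈ A then 1 else 0]
  exact Fin.sum_univ_eq_sum_range (fun i => if x i ∈ A then 1 else 0) n

theorem orderStat_le_iff (x : ℕ → Str b) {n l : ℕ} (hl : 1 ≤ l ∧ l ≤ n) (z : Str b) :
    toLex (orderStat x n l) ≤ toLex z ↔ l ≤ countIn x {y | toLex y ≤ toLex z} n := by
  classical
  rw [orderStat, dif_pos hl]
  set f : Fin n → Lex (Str b) := fun i => toLex (x i)
  have h := Tuple.lt_card_le_iff_apply_le_of_monotone (j := ⟨l - 1, by omega⟩)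
    (a := toLex z) (Tuple.monotone_sort f)
  have e := card_sort_eq_countIn x n {y | toLex y ≤ toLex z} (Tuple.sort f)
  rw [← e]
  refine h.symm.trans ?_
  change l - 1 < _ ↔ _
  rw [Nat.sub_lt_iff_lt_add hl.1, Nat.lt_add_one_iff]
  exact Iff.of_eq (by congr!)

theorem orderStat_lt_iff (x : ℕ → Str b) {n l : ℕ} (hl : 1 ≤ l ∧ l ≤ n) (z : Str b) :
    toLex (orderStat x n l) < toLex z ↔ l ≤ countIn x {y | toLex y < toLex z} n := by
  classical
  rw [orderStat, dif_pos hl]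
  set f : Fin n → Lex (Str b) := fun i => toLex (x i)
  have h := Tuple.lt_card_lt_iff_apply_lt_of_monotone (j := ⟨l - 1, by omega⟩)
    (a := toLex z) (Tuple.monotone_sort f)
  have e := card_sort_eq_countIn x n {y | toLex y < toLex z} (Tuple.sort f)
  rw [← e]
  refine h.symm.trans ?_
  change l - 1 < _ ↔ _
  rw [Nat.sub_lt_iff_lt_add hl.1, Nat.lt_add_one_iff]
  exact Iff.of_eq (by congr!)

/-- The number of ordered pairs of distinct indices below `n` whose strings agree in the first `k`
symbols. -/
def pairCount (x : ℕ → Str b) (n k : ℕ) : ℕ :=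
  ((Finset.range n).offDiag.filter fun p => ∀ l < k, x p.1 l = x p.2 l).card

theorem prefixCount_mul_self_le (x : ℕ → Str b) (n k : ℕ) (v : Str b) :
    prefixCount x n k v * prefixCount x n k v ≤ pairCount x n k + prefixCount x n k v := by
  rw [prefixCount, pairCount]
  set s := (Finset.range n).filter fun i => ∀ l < k, x i l = v l
  have h : s.offDiag.card ≤
      ((Finset.range n).offDiag.filter fun p => ∀ l < k, x p.1 l = x p.2 l).card := by
    refine Finset.card_le_card fun p hp => ?_
    rw [Finset.mem_offDiag] at hp
    simp only [s, Finset.mem_filter] at hp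
    rw [Finset.mem_filter, Finset.mem_offDiag]
    exact ⟨⟨hp.1.1, hp.2.1.1, hp.2.2⟩, fun l hl => (hp.1.2 l hl).trans (hp.2.1.2 l hl).symm⟩
  rw [Finset.offDiag_card] at h
  omega

/-- The contribution of level `k` to `pathCost`. -/
def levelCost (x : ℕ → Str b) (n : ℕ) (v : Str b) (k : ℕ) : ℝ :=
  if 1 < prefixCount x n k v then (prefixCount x n k v : ℝ) else 0

theorem levelCost_nonneg (x : ℕ → Str b) (n : ℕ) (v : Str b) (k : ℕ) : 0 ≤ levelCost x n v k := by
  unfold levelCost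
  split_ifs
  · exact Nat.cast_nonneg _
  · exact le_rfl

theorem abs_levelCost_sub_le (x : ℕ → Str b) (n : ℕ) (v : Str b) (k : ℕ) :
    |levelCost x n v k - prefixCount x n k v| ≤ 1 := by
  unfold levelCost
  split_ifs with h
  · simp
  · rw [zero_sub, abs_neg, Nat.abs_cast]
    exact_mod_cast not_lt.1 h

/-- A bound on the cost of a level that is uniform in the string `v` and linear in the number of
pairs; the free parameter `δ` replaces a square root. -/
theorem levelCost_le (x : ℕ → Str b) (n : ℕ) (v : Str b) (k : ℕ) {δ : ℝ} (hδ : 0 < δ) :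
    levelCost x n v k ≤ δ + 2 * pairCount x n k / δ := by
  unfold levelCost
  split_ifs with h
  · have h₁ : (prefixCount x n k v : ℝ) * prefixCount x n k v ≤
        pairCount x n k + prefixCount x n k v := by
      exact_mod_cast prefixCount_mul_self_le x n k v
    have h₂ : (2 : ℝ) ≤ prefixCount x n k v := by exact_mod_cast h
    set L := (prefixCount x n k v : ℝ)
    rw [← sub_le_iff_le_add', le_div_iff₀ hδ]
    nlinarith [sq_nonneg (L - δ)]
  · positivity

/-- A random majorant of the cost of all levels from `K` on, in `[0, ∞]`. -/
def pairTail (x : ℕ → Str b) (n K : ℕ) (r : ℝ) : ENNReal :=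
  ∑' k, ENNReal.ofReal (2 * pairCount x n (k + K) / (r ^ (k + K) * n))

/-- If the pair counts are small, the search cost of every string is close to the contribution of
its first `K` levels; in particular the series defining it converges. -/
theorem abs_pathCost_sub_le (x : ℕ → Str b) {n : ℕ} (hn : 1 ≤ n) (K : ℕ) {r : ℝ} (hr0 : 0 < r)
    (hr1 : r < 1) {η : ℝ} (hη : 0 < η) (h : pairTail x n K r < ENNReal.ofReal η) (v : Str b) :
    |pathCost x n v - ∑ k ∈ Finset.range K, (prefixCount x n k v : ℝ)| ≤
      K + n * (r ^ K / (1 - r)) + η := by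
  have hn' : (0 : ℝ) < n := by exact_mod_cast hn
  set f : ℕ → ℝ := fun k => 2 * pairCount x n (k + K) / (r ^ (k + K) * n) with hf
  have hf0 : ∀ k, 0 ≤ f k := fun k => by positivity
  have hfs : Summable f := by
    have := ENNReal.summable_toReal (h.ne_top)
    exact this.congr fun k => ENNReal.toReal_ofReal (hf0 k)
  have hft : ∑' k, f k ≤ η := by
    rw [pairTail, ← ENNReal.ofReal_tsum_of_nonneg hf0 hfs] at h
    exact ((ENNReal.ofReal_lt_ofReal_iff hη).1 h).le
  have hg : Summable fun k => r ^ (k + K) * n :=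
    ((summable_nat_add_iff K).2 (summable_geometric_of_lt_one hr0.le hr1)).mul_right _
  have hgt : ∑' k, r ^ (k + K) * n = n * (r ^ K / (1 - r)) := by
    simp only [pow_add]
    rw [tsum_mul_right, tsum_mul_right, tsum_geometric_of_lt_one hr0.le hr1]
    ring
  have hle : ∀ k, levelCost x n v (k + K) ≤ r ^ (k + K) * n + f k :=
    fun k => levelCost_le x n v (k + K) (by positivity)
  have htail : Summable fun k => levelCost x n v (k + K) :=
    .of_nonneg_of_le (fun k => levelCost_nonneg x n v _) hle (hg.add hfs)
  have hs : Summable (levelCost x n v) := (summable_nat_add_iff K).1 htail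
  have h₁ : ∑' k, levelCost x n v (k + K) ≤ n * (r ^ K / (1 - r)) + η := by
    refine (htail.tsum_le_tsum hle (hg.add hfs)).trans ?_
    rw [hg.tsum_add hfs, hgt]
    gcongr
  have h₂ : 0 ≤ ∑' k, levelCost x n v (k + K) := tsum_nonneg fun k => levelCost_nonneg x n v _
  have h₃ : |∑ k ∈ Finset.range K, levelCost x n v k -
      ∑ k ∈ Finset.range K, (prefixCount x n k v : ℝ)| ≤ K := by
    rw [← Finset.sum_sub_distrib]
    refine (Finset.abs_sum_le_sum_abs _ _).trans ?_
    refine (Finset.sum_le_sum fun k _ => abs_levelCost_sub_le x n v k).trans ?_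
    simp
  change |∑' k, levelCost x n v k - _| ≤ _
  rw [← hs.sum_add_tsum_nat_add K]
  rw [abs_le] at h₃ ⊢
  constructor <;> linarith [h₃.1, h₃.2]

section Sample

variable {M : MarkovSource b} {Ω : Type*} [MeasurableSpace Ω] {P : Measure Ω}
  [IsProbabilityMeasure P] {S : ℕ → Ω → Str b}

/-- Two independent strings agree in `k` symbols with probability at most that of the most likely
prefix. -/
theorem measure_agree_le (hS : IsMarkovSample M P S) {q : ℝ}
    (hq : ∀ w k, M.prefixProb w k ≤ q ^ k) {i j : ℕ} (hij : i ≠ j) (k : ℕ) :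
    P {ω | ∀ l < k, S i ω l = S j ω l} ≤ ENNReal.ofReal (q ^ k) := by
  have := Measure.isProbabilityMeasure_map (μ := P) (hS.measurable i).aemeasurable
  have := Measure.isProbabilityMeasure_map (μ := P) (hS.measurable j).aemeasurable
  have hms : MeasurableSet {p : Str b × Str b | ∀ l < k, p.2 l = p.1 l} :=
    measurableSet_agree measurable_snd measurable_fst k
  have hprod := (indepFun_iff_map_prod_eq_prod_map_map (hS.measurable j).aemeasurable
    (hS.measurable i).aemeasurable).1 (hS.indep.indepFun hij.symm)
  calc P {ω | ∀ l < k, S i ω l = S j ω l}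
      = P.map (fun ω => (S j ω, S i ω)) {p : Str b × Str b | ∀ l < k, p.2 l = p.1 l} :=
        (Measure.map_apply ((hS.measurable j).prodMk (hS.measurable i)) hms).symm
    _ = ∫⁻ y, P.map (S i) (PiNat.cylinder y k) ∂P.map (S j) := by
        rw [hprod, Measure.prod_apply hms]
        rfl
    _ ≤ ∫⁻ _y, ENNReal.ofReal (q ^ k) ∂P.map (S j) :=
        lintegral_mono fun y => (isLaw_map hS i y k).trans_le (ENNReal.ofReal_le_ofReal (hq y k))
    _ = ENNReal.ofReal (q ^ k) := by simp

theorem pairCount_eq_sum (x : ℕ → Str b) (n k : ℕ) : (pairCount x n k : ENNReal) =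
    ∑ p ∈ (Finset.range n).offDiag, if ∀ l < k, x p.1 l = x p.2 l then 1 else 0 := by
  rw [pairCount, Finset.card_filter]
  push_cast
  rfl

omit [IsProbabilityMeasure P] in
theorem measurable_pairCount (hS : IsMarkovSample M P S) (n k : ℕ) :
    Measurable fun ω => (pairCount (fun i => S i ω) n k : ENNReal) := by
  simp only [pairCount_eq_sum]
  exact Finset.measurable_sum _ fun p _ => Measurable.ite
    (measurableSet_agree (hS.measurable _) (hS.measurable _) k) measurable_const measurable_const

theorem lintegral_pairCount_le (hS : IsMarkovSample M P S) {q : ℝ}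
    (hq : ∀ w k, M.prefixProb w k ≤ q ^ k) (n k : ℕ) :
    ∫⁻ ω, (pairCount (fun i => S i ω) n k : ENNReal) ∂P ≤ n * n * ENNReal.ofReal (q ^ k) := by
  simp only [pairCount_eq_sum]
  rw [lintegral_finsetSum _ fun p _ => Measurable.ite
    (measurableSet_agree (hS.measurable _) (hS.measurable _) k) measurable_const measurable_const]
  calc ∑ p ∈ (Finset.range n).offDiag,
        ∫⁻ ω, (if ∀ l < k, S p.1 ω l = S p.2 ω l then 1 else 0) ∂P
      ≤ ∑ _p ∈ (Finset.range n).offDiag, ENNReal.ofReal (q ^ k) := by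
        refine Finset.sum_le_sum fun p hp => ?_
        refine le_trans (le_of_eq ?_) (measure_agree_le hS hq (Finset.mem_offDiag.1 hp).2.2 k)
        rw [← lintegral_indicator_one
          (measurableSet_agree (hS.measurable p.1) (hS.measurable p.2) k)]
        exact lintegral_congr fun ω => by simp [Set.indicator_apply]
    _ ≤ n * n * ENNReal.ofReal (q ^ k) := by
        rw [Finset.sum_const, nsmul_eq_mul, Finset.offDiag_card, Finset.card_range]
        gcongr
        exact_mod_cast Nat.sub_le _ _

/-- Markov's inequality for `pairTail`. With `q = r²` the expected number of pairs at level `k` is at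
most `n² r ^ (2 k)`, so that the weights `r ^ (-k)` still leave a convergent series. -/
theorem measure_pairTail_le (hS : IsMarkovSample M P S) {r : ℝ} (hr0 : 0 < r) (hr1 : r < 1)
    (hr : ∀ w k, M.prefixProb w k ≤ (r * r) ^ k) {n : ℕ} (hn : 1 ≤ n) (K : ℕ) {δ : ℝ}
    (hδ : 0 < δ) :
    P.real {ω | ENNReal.ofReal (δ * n) ≤ pairTail (fun i => S i ω) n K r} ≤
      2 * (r ^ K / (1 - r)) / δ := by
  have hn' : (0 : ℝ) < n := by exact_mod_cast hn
  have h1r : 0 < 1 - r := sub_pos.2 hr1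
  have hterm : ∀ k ω, ENNReal.ofReal
      (2 * pairCount (fun i => S i ω) n (k + K) / (r ^ (k + K) * n)) =
      ENNReal.ofReal (2 / (r ^ (k + K) * n)) *
        (pairCount (fun i => S i ω) n (k + K) : ENNReal) := by
    intro k ω
    rw [← ENNReal.ofReal_natCast, ← ENNReal.ofReal_mul (by positivity)]
    congr 1
    ring
  have hint : ∫⁻ ω, pairTail (fun i => S i ω) n K r ∂P ≤
      ENNReal.ofReal (2 * n * (r ^ K / (1 - r))) := by
    have hs : Summable fun k => 2 * n * r ^ (k + K) :=
      ((summable_nat_add_iff K).2 (summable_geometric_of_lt_one hr0.le hr1)).mul_left _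
    have ht : ∑' k, 2 * n * r ^ (k + K) = 2 * n * (r ^ K / (1 - r)) := by
      simp only [pow_add]
      rw [tsum_mul_left, tsum_mul_right, tsum_geometric_of_lt_one hr0.le hr1]
      ring
    rw [← ht, ENNReal.ofReal_tsum_of_nonneg (fun k => by positivity) hs]
    simp only [pairTail, hterm]
    rw [lintegral_tsum fun k => ((measurable_pairCount hS n _).const_mul _).aemeasurable]
    refine ENNReal.tsum_le_tsum fun k => ?_
    rw [lintegral_const_mul _ (measurable_pairCount hS n _)]
    refine (mul_le_mul_right (lintegral_pairCount_le hS hr n (k + K)) _).trans (le_of_eq ?_)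
    rw [← ENNReal.ofReal_natCast, ← ENNReal.ofReal_mul hn'.le,
      ← ENNReal.ofReal_mul (by positivity), ← ENNReal.ofReal_mul (by positivity)]
    congr 1
    rw [mul_pow]
    field_simp
  have hmeas : Measurable fun ω => pairTail (fun i => S i ω) n K r := by
    simp only [pairTail, hterm]
    exact Measurable.tsum fun k => (measurable_pairCount hS n _).const_mul _
  have hmk := (mul_meas_ge_le_lintegral (μ := P) hmeas (ENNReal.ofReal (δ * n))).trans hint
  rw [le_div_iff₀ hδ]
  have h := ENNReal.toReal_mono ENNReal.ofReal_ne_top hmk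
  rw [ENNReal.toReal_mul, ENNReal.toReal_ofReal (by positivity),
    ENNReal.toReal_ofReal (by positivity)] at h
  change δ * n * P.real _ ≤ _ at h
  refine le_of_mul_le_mul_left ?_ hn'
  linarith

end Sample

/-! ### Lack of tightness at a jump -/

/-- If more than `s` strings are at most `y`, but at most `s` of them are smaller than every string
in the cylinder of `y`, then the string of rank `⌊s⌋ + 1` lies in this cylinder. -/
theorem orderStat_mem_cylinder [NeZero b] (x : ℕ → Str b) {n K : ℕ} {y : Str b} {s : ℝ}
    (hs0 : 0 ≤ s) (hsn : s < n) (h₁ : s < countIn x {z | toLex z ≤ toLex y} n)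
    (h₂ : (countIn x {z | toLex z < toLex (constTail y K ⊥)} n : ℝ) ≤ s) :
    orderStat x n (⌊s⌋₊ + 1) ∈ PiNat.cylinder y K := by
  have hl : 1 ≤ ⌊s⌋₊ + 1 ∧ ⌊s⌋₊ + 1 ≤ n :=
    ⟨Nat.le_add_left _ _, Nat.succ_le_of_lt ((Nat.floor_lt hs0).2 hsn)⟩
  refine mem_cylinder_iff_toLex.2 ⟨?_, ?_⟩
  · by_contra! h
    have h₃ := (orderStat_lt_iff x hl _).1 h
    have h₄ := Nat.lt_floor_add_one s
    have h₅ : ((⌊s⌋₊ + 1 : ℕ) : ℝ) ≤ _ := Nat.cast_le.2 h₃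
    push_cast at h₅
    linarith
  · exact ((orderStat_le_iff x hl y).2 (Nat.succ_le_of_lt ((Nat.floor_lt hs0).2 h₁))).trans
      (le_constTail_top y K)

/-- On the intersection of the typical events, the cost at rank `⌊s⌋ + 1` is close to `m(y) n`,
where `y` is the left one of two neighbouring strings. -/
theorem abs_radixCost_sub_le [NeZero b] {M : MarkovSource b} {q r : ℝ} (hr0 : 0 < r) (hr1 : r < 1)
    (hq0 : 0 < q) (hq1 : q < 1) (hq : ∀ w k, M.prefixProb w k ≤ q ^ k) (x : ℕ → Str b)
    {n K : ℕ} (hn : 1 ≤ n) {y : Str b} {s δ η : ℝ} (hη : 0 < η) (hs0 : 0 ≤ s) (hsn : s < n)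
    (h₁ : s < countIn x {z | toLex z ≤ toLex y} n)
    (h₂ : (countIn x {z | toLex z < toLex (constTail y K ⊥)} n : ℝ) ≤ s)
    (h₃ : ∀ k < K, |(countIn x (PiNat.cylinder y k) n : ℝ) - n * M.prefixProb y k| ≤ δ * n)
    (h₄ : pairTail x n K r < ENNReal.ofReal (η * n)) :
    |radixCost x n (⌊s⌋₊ + 1) - M.m y * n| ≤
      K + (r ^ K / (1 - r) + η + K * δ + q ^ K / (1 - q)) * n := by
  have hn' : (0 : ℝ) < n := by exact_mod_cast hn
  have hl : ⌊s⌋₊ + 1 ≤ n := Nat.succ_le_of_lt ((Nat.floor_lt hs0).2 hsn)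
  have hmem := orderStat_mem_cylinder x hs0 hsn h₁ h₂
  have e₁ := abs_pathCost_sub_le x hn K hr0 hr1 (by positivity) h₄
    (orderStat x n (⌊s⌋₊ + 1))
  have e₂ : ∑ k ∈ Finset.range K, (prefixCount x n k (orderStat x n (⌊s⌋₊ + 1)) : ℝ) =
      ∑ k ∈ Finset.range K, (countIn x (PiNat.cylinder y k) n : ℝ) := by
    refine Finset.sum_congr rfl fun k hk => ?_
    rw [prefixCount_eq_countIn, PiNat.mem_cylinder_iff_eq.1
      (PiNat.cylinder_anti y (Finset.mem_range.1 hk).le hmem)]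
  have e₃ : |∑ k ∈ Finset.range K, (countIn x (PiNat.cylinder y k) n : ℝ) -
      n * ∑ k ∈ Finset.range K, M.prefixProb y k| ≤ K * (δ * n) := by
    rw [Finset.mul_sum, ← Finset.sum_sub_distrib]
    refine (Finset.abs_sum_le_sum_abs _ _).trans ?_
    refine (Finset.sum_le_sum fun k hk => h₃ k (Finset.mem_range.1 hk)).trans ?_
    simp
  have e₄ := mul_le_mul_of_nonneg_left (sum_prefixProb_le_m hq0 hq1 hq y K) hn'.le
  have e₅ := mul_le_mul_of_nonneg_left (m_le_sum_prefixProb_add hq0 hq1 hq y K) hn'.le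
  rw [e₂] at e₁
  rw [radixCost, min_eq_left hl]
  rw [abs_le] at e₁ e₃ ⊢
  constructor <;> nlinarith [e₁.1, e₁.2, e₃.1, e₃.2]

/-- At the common level of two neighbouring strings with different values of `m`, the normalized
cost is unbounded in probability: the centring uses the right neighbour, but with probability
bounded away from zero the string of the relevant rank is close to the left one. -/
theorem exists_lt_measure_normProc [NeZero b] {M : MarkovSource b} {Ω : Type*}
    [MeasurableSpace Ω] {P : Measure Ω} [IsProbabilityMeasure P] {S : ℕ → Ω → Str b}
    (hS : IsMarkovSample M P S) {w : Str b} {k₀ : ℕ} {a a' : Fin b} (ha : (a' : ℕ) = a + 1)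
    (hne : M.m (maxBelow w k₀ a) ≠ M.m (minAbove w k₀ a'))
    (ht0 : 0 < strCDF (P.map (S 0)) id (maxBelow w k₀ a))
    (ht1 : strCDF (P.map (S 0)) id (maxBelow w k₀ a) < 1) :
    ∃ c : ENNReal, 0 < c ∧ ∀ R : ℝ, ∃ n, 1 ≤ n ∧
      c < P {ω | R < |normProc M P S n (strCDF (P.map (S 0)) id (maxBelow w k₀ a)) ω|} := by
  have hν : IsLaw M (P.map (S 0)) := isLaw_map hS 0
  have := Measure.isProbabilityMeasure_map (μ := P) (hS.measurable 0).aemeasurable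
  set y := maxBelow w k₀ a with hy
  set ν := P.map (S 0) with hν'
  set t := strCDF ν id y with ht
  have hquant : strQuantile P (S 0) t = minAbove w k₀ a' := by
    rw [strQuantile_eq_map P (hS.measurable 0)]
    exact hν.strQuantile_strCDF_maxBelow w k₀ ha
  obtain ⟨q, hq0, hq1, hq⟩ := exists_prefixProb_le_pow M
  set r := √q with hr
  have hr0 : 0 < r := Real.sqrt_pos.2 hq0
  have hr1 : r < 1 := by rw [hr, Real.sqrt_lt' one_pos]; simpa using hq1
  have hrr : ∀ w k, M.prefixProb w k ≤ (r * r) ^ k := by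
    rw [hr, Real.mul_self_sqrt hq0.le]; exact hq
  -- the gap between the two limits; five error terms of size `D / 10` leave half of it
  set D := |M.m y - M.m (minAbove w k₀ a')| with hD
  have hD0 : 0 < D := abs_pos.2 (sub_ne_zero.2 hne)
  set A : Set (Str b) := {z | toLex z ≤ toLex y} with hA
  have hAm : MeasurableSet A := measurableSet_toLex_le measurable_id measurable_const
  have hAt : ν.real A = t := rfl
  obtain ⟨c, hc0, hc⟩ := exists_eventually_le_measure_countIn hS hAm
    (by rw [← hν', hAt]; exact ht0) (by rw [← hν', hAt]; exact ht1)
  -- the number `K` of levels that are treated by the law of large numbers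
  obtain ⟨K, hK₁, hK₂, hK₃, hK₄⟩ : ∃ K : ℕ, r ^ K / (1 - r) < D / 10 ∧ q ^ K / (1 - q) < D / 10 ∧
      2 * (r ^ K / (1 - r)) / (D / 10) < c / 4 ∧ k₀ + 1 ≤ K := by
    have l₁ : Tendsto (fun K : ℕ => r ^ K / (1 - r)) atTop (𝓝 0) := by
      simpa using (tendsto_pow_atTop_nhds_zero_of_lt_one hr0.le hr1).div_const (1 - r)
    have l₂ : Tendsto (fun K : ℕ => q ^ K / (1 - q)) atTop (𝓝 0) := by
      simpa using (tendsto_pow_atTop_nhds_zero_of_lt_one hq0.le hq1).div_const (1 - q)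
    have l₃ : Tendsto (fun K : ℕ => 2 * (r ^ K / (1 - r)) / (D / 10)) atTop (𝓝 0) := by
      simpa using (l₁.const_mul 2).div_const (D / 10)
    exact ((l₁.eventually (gt_mem_nhds (by positivity))).and
      ((l₂.eventually (gt_mem_nhds (by positivity))).and
        ((l₃.eventually (gt_mem_nhds (by positivity))).and
          (eventually_ge_atTop (k₀ + 1))))).exists
  set δ := D / (10 * (K + 1)) with hδ
  have hδ0 : 0 < δ := by positivity
  have hKδ : K * δ ≤ D / 10 := by
    rw [hδ, mul_div_assoc', div_le_div_iff₀ (by positivity) (by norm_num)]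
    nlinarith
  set B : Set (Str b) := {z | toLex z < toLex (constTail y K ⊥)} with hB
  have hBm : MeasurableSet B := measurableSet_toLex_lt measurable_id measurable_const
  have hπ := prefixProb_pos M y K
  have hBt : ν.real B = t - M.prefixProb y K := by
    have e : constTail y K ⊤ = y := by
      ext1 l
      rcases lt_or_ge l K with hl | hl
      · exact constTail_of_lt _ hl
      · rw [constTail_of_le _ hl, hy, maxBelow_apply, if_neg (by omega), if_neg (by omega)]
    have h := hν.strCDF_constTail_top y K
    rw [e, hν.strCDF_eq_lt (constTail y K ⊥)] at h
    exact eq_sub_of_add_eq h.symm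
  set E₂ : ℕ → Set Ω := fun n => {ω | M.prefixProb y K * n <
    |(countIn (fun i => S i ω) B n : ℝ) - n * ν.real B|} with hE₂
  set E₃ : ℕ → ℕ → Set Ω := fun k n => {ω | δ * n <
    |(countIn (fun i => S i ω) (PiNat.cylinder y k) n : ℝ) - n * ν.real (PiNat.cylinder y k)|}
    with hE₃
  set E₄ : ℕ → Set Ω := fun n =>
    {ω | ENNReal.ofReal (D / 10 * n) ≤ pairTail (fun i => S i ω) n K r} with hE₄
  have hlim : Tendsto (fun n => P.real (E₂ n) + ∑ k ∈ Finset.range K, P.real (E₃ k n)) atTop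
      (𝓝 (0 + ∑ _k ∈ Finset.range K, 0)) :=
    (tendsto_measure_countIn hS hBm hπ).add (tendsto_finsetSum _ fun k _ =>
      tendsto_measure_countIn hS (measurableSet_cylinder y k) hδ0)
  simp only [Finset.sum_const_zero, add_zero] at hlim
  refine ⟨ENNReal.ofReal (c / 4), ENNReal.ofReal_pos.2 (by positivity), fun R => ?_⟩
  have hsqrt : Tendsto (fun n : ℕ => √(n : ℝ)) atTop atTop :=
    Real.tendsto_sqrt_atTop.comp tendsto_natCast_atTop_atTop
  obtain ⟨n, hnc, hn₂, hnK, hnR, hn⟩ := (hc.and ((hlim.eventually (gt_mem_nhds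
    (show 0 < c / 4 by positivity))).and ((tendsto_natCast_atTop_atTop.eventually
      (eventually_ge_atTop (K / (D / 10) : ℝ))).and ((hsqrt.eventually
        (eventually_gt_atTop (R / (D / 2)))).and (eventually_ge_atTop 1))))).exists
  refine ⟨n, hn, ?_⟩
  have hn' : (0 : ℝ) < n := by exact_mod_cast hn
  rw [div_le_iff₀ (by positivity)] at hnK
  rw [div_lt_iff₀ (by positivity)] at hnR
  set L : Set Ω := {ω | R < |normProc M P S n t ω|} with hL
  have hsub : {ω | n * ν.real A < countIn (fun i => S i ω) A n} ⊆
      L ∪ (E₂ n ∪ ⋃ k ∈ Finset.range K, E₃ k n) ∪ E₄ n := by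
    intro ω hω
    by_contra hcon
    simp only [Set.mem_union, Set.mem_iUnion, Finset.mem_range, not_or, not_exists] at hcon
    obtain ⟨⟨hL', hE₂', hE₃'⟩, hE₄'⟩ := hcon
    refine hL' ?_
    have h₂ : |(countIn (fun i => S i ω) B n : ℝ) - n * ν.real B| ≤ M.prefixProb y K * n :=
      not_lt.1 hE₂'
    replace h₂ := (abs_le.1 h₂).2
    rw [hBt] at h₂
    have hbound := abs_radixCost_sub_le hr0 hr1 hq0 hq1 hq (fun i => S i ω) hn (y := y) (K := K)
      (s := t * n) (δ := δ) (η := D / 10) (by positivity) (by positivity)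
      (mul_lt_of_lt_one_left hn' ht1) (by rw [mul_comm]; exact hω) (by linarith)
      (fun k hk => by rw [← hν.real_cylinder]; exact not_lt.1 (hE₃' k hk)) (not_le.1 hE₄')
    have hclose : |radixCost (fun i => S i ω) n (⌊t * n⌋₊ + 1) - M.m y * n| ≤ D / 2 * n := by
      refine hbound.trans ?_
      have h₅ : r ^ K / (1 - r) + D / 10 + K * δ + q ^ K / (1 - q) ≤ 4 * (D / 10) := by linarith
      have h₆ := mul_le_mul_of_nonneg_right h₅ hn'.le
      linarith
    have hgap : D * n ≤ |radixCost (fun i => S i ω) n (⌊t * n⌋₊ + 1) - M.m y * n| +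
        |radixCost (fun i => S i ω) n (⌊t * n⌋₊ + 1) - M.m (minAbove w k₀ a') * n| := by
      rw [hD, ← abs_of_pos hn', ← abs_mul, abs_of_pos hn',
        abs_sub_comm (radixCost _ n _) (M.m y * n)]
      refine le_trans (le_of_eq (congrArg _ ?_)) (abs_add_le _ _)
      ring
    change R < |normProc M P S n t ω|
    rw [normProc, hquant, abs_div, abs_of_nonneg (Real.sqrt_nonneg _),
      lt_div_iff₀ (Real.sqrt_pos.2 hn')]
    have hs := Real.mul_self_sqrt hn'.le
    have h₇ := mul_lt_mul_of_pos_right hnR (Real.sqrt_pos.2 hn')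
    nlinarith
  have hmain : c ≤ P.real L + (P.real (E₂ n) + ∑ k ∈ Finset.range K, P.real (E₃ k n)) +
      P.real (E₄ n) :=
    calc c ≤ P.real {ω | n * ν.real A < countIn (fun i => S i ω) A n} := hnc
      _ ≤ P.real (L ∪ (E₂ n ∪ ⋃ k ∈ Finset.range K, E₃ k n) ∪ E₄ n) := measureReal_mono hsub
      _ ≤ _ := by
        refine (measureReal_union_le _ _).trans ?_
        gcongr
        refine (measureReal_union_le _ _).trans ?_
        gcongr
        refine (measureReal_union_le _ _).trans ?_
        gcongr
        exact measureReal_biUnion_finset_le _ _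
  have h₄ : P.real (E₄ n) ≤ 2 * (r ^ K / (1 - r)) / (D / 10) :=
    measure_pairTail_le hS hr0 hr1 hrr hn K (by positivity)
  rw [ENNReal.ofReal_lt_iff_lt_toReal (by positivity) (measure_ne_top _ _)]
  change c / 4 < P.real L
  linarith

end RadixSelection

end

theorem corollary2p11 {b : ℕ} [NeZero b] (hb : 2 ≤ b) (M : MarkovSource b)
    (hM : ¬ ∃ β : ℝ, 0 < β ∧ ∀ i r : Fin b, M.trans i r = geomWeight b β r)
    {Ω : Type*} [MeasurableSpace Ω] (P : Measure Ω) [IsProbabilityMeasure P]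
    (S : ℕ → Ω → Str b) (hS : IsMarkovSample M P S)
    (u v : ℝ) (hu : 0 ≤ u) (huv : u < v) (hv : v ≤ 1) :
    -- the processes are random elements of `D[u,v]`
    (∀ n : ℕ, 1 ≤ n →
      (∀ ω, IsCadlag (fun t : Set.Icc u v => normProc M P S n t ω)) ∧
      AEMeasurable (fun ω => SkorokhodSpace.restrict u v (fun t => normProc M P S n t ω)) P) ∧
    -- their distributions on `D[u,v]` are not tight
    ¬ IsTightMeasureSet {ν : Measure (SkorokhodSpace u v) | ∃ n : ℕ, 1 ≤ n ∧
      ν = P.map (fun ω => SkorokhodSpace.restrict u v (fun t => normProc M P S n t ω))} ∧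
    -- some one-dimensional marginal is not tight
    (∃ t ∈ Set.Icc u v,
      (∀ n : ℕ, 1 ≤ n → AEMeasurable (normProc M P S n t) P) ∧
      ¬ IsTightMeasureSet {ν : Measure ℝ | ∃ n : ℕ, 1 ≤ n ∧
        ν = P.map (normProc M P S n t)}) := by
  open RadixSelection in
  have hν : IsLaw M (P.map (S 0)) := isLaw_map hS 0
  have hprob := Measure.isProbabilityMeasure_map (μ := P) (hS.measurable 0).aemeasurable
  have hcad : ∀ n : ℕ, 1 ≤ n → ∀ ω, IsCadlag (fun t : Set.Icc u v => normProc M P S n t ω) := by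
    intro n hn ω
    simp only [normProc_eq_stepPath M P (hS.measurable 0)]
    exact isCadlag_restrict (hν.isCadlag_stepPath hb hn _) u v
  have hmeas : ∀ n : ℕ, 1 ≤ n → AEMeasurable
      (fun ω => SkorokhodSpace.restrict u v (fun t => normProc M P S n t ω)) P := fun n hn =>
    (measurable_restrict_normProc M P hS.measurable hν hb hn u v).aemeasurable
  obtain ⟨w, k, a, a', ha, ⟨htu, htv⟩, hne⟩ := hν.exists_m_maxBelow_ne hM hu huv hv
  obtain ⟨c, hc, hlarge⟩ := exists_lt_measure_normProc hS ha hne (hu.trans_lt htu)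
    (htv.trans_le hv)
  set t := strCDF (P.map (S 0)) id (maxBelow w k a)
  have ht : t ∈ Set.Icc u v := ⟨htu.le, htv.le⟩
  have hmeas' : ∀ n : ℕ, 1 ≤ n → AEMeasurable (normProc M P S n t) P := fun n _ =>
    (measurable_normProc M P hS.measurable n t).aemeasurable
  refine ⟨fun n hn => ⟨hcad n hn, hmeas n hn⟩,
    not_isTightMeasureSet_skorokhod hmeas ⟨t, ht⟩ hc fun R => ?_,
    t, ht, hmeas', not_isTightMeasureSet_real hmeas' hc hlarge⟩
  obtain ⟨n, hn, hlt⟩ := hlarge R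
  refine ⟨n, hn, hlt.trans_eq ?_⟩
  congr 1
  ext ω
  rw [Set.mem_ofPred_eq, Set.mem_ofPred_eq, SkorokhodSpace.restrict, dif_pos (hcad n hn ω)]
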